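/- Let $\mathsf{RCA}_0$ be the function-based second order system with classical logic whose variables range over natural numbers (type $0$) and functions from $\mathbb N$ to $\mathbb N$ (type $1$). Its terms are built from $0$, successor, $+$, $\cdot$, function application, $\lambda$-abstraction over number variables, and primitive recursion of type $0$. Its axioms are those of equality on numbers; extensionality; the basic arithmetical axioms; the defining equations of $\lambda$-abstraction and primitive recursion; induction for quantifier-free formulas; and the quantifier-free choice scheme $\mathsf{QF}\text{-}\mathsf{AC}^{0,0}$, $\forall x\,\exists y\,A_0(x,y)\to\exists f\,\forall x\,A_0(x,f(x))$ (in all schemes parameters of both types are allowed). Within $\mathsf{RCA}_0$, a real number is a sequence $f$ of (coded) rationals with $|f(k)-f(k+i)|\le 2^{-k}$ for all $k,i$; two real numbers $f,g$ are equal if $|f(k)-g(k)|\le 2\cdot 2^{-k}$ for all $k$; and a complex number is a pair of real numbers. Then $\mathsf{RCA}_0$ proves the sentence stating: for every $2\times 2$ matrix $M$ of complex numbers there are $2\times2$ matrices $U$, $J$ of complex numbers such that $U$ is invertible, $M=UJU^{-1}$, and $J$ consists of Jordan blocks, that is, $J=\begin{pmatrix}\lambda&0\\0&\mu\end{pmatrix}$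 or $J=\begin{pmatrix}\lambda&1\\0&\lambda\end{pmatrix}$ for some complex $\lambda,\mu$. -/

import Mathlib

/-! The function-based second order system `RCA₀` and its language, and the sentence of that language
saying that every `2 × 2` complex matrix has a Jordan decomposition. -/

namespace RCA

/-! ### Language

Two sorts: natural numbers (type `0`) and functions from numbers to numbers (type `1 = 0 → 0`).
Variables are de Bruijn indices, counted separately for the two sorts: a binder for a variable of
sort `s` captures index `0` of sort `s`, raises the other indices of sort `s` by one, and leaves the
indices of the other sort alone. -/

/-- The two sorts of variables: type `0` and type `1`. -/
inductive Srt where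
  | num
  | fn

/-- Terms of type `0` and of type `1`. -/
inductive Term : Srt → Type where
  /-- the variable of sort `s` with index `i` -/
  | var (s : Srt) (i : ℕ) : Term s
  | zero : Term .num
  | succ (t : Term .num) : Term .num
  | add (t u : Term .num) : Term .num
  | mul (t u : Term .num) : Term .num
  /-- the value of the function `f` at `t` -/
  | app (f : Term .fn) (t : Term .num) : Term .num
  /-- `λ x. t`; the variable `x` is number variable `0` in `t` -/
  | lam (t : Term .num) : Term .fn
  /-- Primitive recursion of type `0`: `prec a b t` is the value `R(t)`, where `R(0) = a` and
  `R(n + 1) = b(R(n), n)`; in `b` the value `R(n)` is number variable `0` and the counter `n` is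
  number variable `1`. -/
  | prec (a b t : Term .num) : Term .num

/-- The number variable with index `i`. -/
abbrev Term.nv (i : ℕ) : Term .num := .var .num i

/-- The function variable with index `i`. -/
abbrev Term.fv (i : ℕ) : Term .fn := .var .fn i

/-- Renamings of variables. -/
abbrev Ren : Type := Srt → ℕ → ℕ

/-- The renaming that makes room for a new variable of the given sort. -/
def Ren.shift : Srt → Ren
  | .num, .num, i => i + 1
  | .num, .fn, i => i
  | .fn, .num, i => i
  | .fn, .fn, i => i + 1

/-- A renaming, carried under a binder of the given sort. -/
def Ren.up (ρ : Ren) : Srt → Ren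
  | .num, .num, 0 => 0
  | .num, .num, i + 1 => ρ .num i + 1
  | .num, .fn, i => ρ .fn i
  | .fn, .num, i => ρ .num i
  | .fn, .fn, 0 => 0
  | .fn, .fn, i + 1 => ρ .fn i + 1

/-- Renaming the variables of a term. -/
def Term.rename : {s : Srt} → Term s → Ren → Term s
  | _, .var s i, ρ => .var s (ρ s i)
  | _, .zero, _ => .zero
  | _, .succ t, ρ => .succ (t.rename ρ)
  | _, .add t u, ρ => .add (t.rename ρ) (u.rename ρ)
  | _, .mul t u, ρ => .mul (t.rename ρ) (u.rename ρ)
  | _, .app f t, ρ => .app (f.rename ρ) (t.rename ρ)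
  | _, .lam t, ρ => .lam (t.rename (ρ.up .num))
  | _, .prec a b t, ρ =>
      .prec (a.rename ρ) (b.rename ((ρ.up .num).up .num)) (t.rename ρ)

/-- A term, moved under a binder of sort `r`. -/
def Term.lift {s : Srt} (t : Term s) (r : Srt) : Term s := t.rename (Ren.shift r)

/-- Simultaneous substitutions. -/
abbrev Sub : Type := (s : Srt) → ℕ → Term s

/-- A substitution, carried under a binder of the given sort. -/
def Sub.up (σ : Sub) : Srt → Sub
  | .num, .num, 0 => .nv 0
  | .num, .num, i + 1 => (σ .num i).lift .num
  | .num, .fn, i => (σ .fn i).lift .num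
  | .fn, .num, i => (σ .num i).lift .fn
  | .fn, .fn, 0 => .fv 0
  | .fn, .fn, i + 1 => (σ .fn i).lift .fn

/-- Capture-avoiding substitution in a term. -/
def Term.subst : {s : Srt} → Term s → Sub → Term s
  | _, .var s i, σ => σ s i
  | _, .zero, _ => .zero
  | _, .succ t, σ => .succ (t.subst σ)
  | _, .add t u, σ => .add (t.subst σ) (u.subst σ)
  | _, .mul t u, σ => .mul (t.subst σ) (u.subst σ)
  | _, .app f t, σ => .app (f.subst σ) (t.subst σ)
  | _, .lam t, σ => .lam (t.subst (σ.up .num))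
  | _, .prec a b t, σ =>
      .prec (a.subst σ) (b.subst ((σ.up .num).up .num)) (t.subst σ)

/-- Replace variable `0` of the sort of `t` by `t`, and lower the other variables of this sort. -/
def Sub.single : {s : Srt} → Term s → Sub
  | .num, t, .num, 0 => t
  | .num, _, .num, i + 1 => .nv i
  | .num, _, .fn, i => .fv i
  | .fn, _, .num, i => .nv i
  | .fn, t, .fn, 0 => t
  | .fn, _, .fn, i + 1 => .fv i

/-- Replace number variables `0` and `1` by `t` and `u`, and lower the others by two. -/
def Sub.double (t u : Term .num) : Sub
  | .num, 0 => t
  | .num, 1 => u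
  | .num, i + 2 => .nv i
  | .fn, i => .fv i

/-- Replace number variable `0` by its successor. -/
def Sub.next : Sub
  | .num, 0 => .succ (.nv 0)
  | .num, i + 1 => .nv (i + 1)
  | .fn, i => .fv i

/-- Turns `φ(y, x)`, with `y` and `x` number variables `0` and `1`, into `φ(f(x), x)`, with `x` number
variable `0` and `f` function variable `0`. -/
def Sub.choice : Sub
  | .num, 0 => .app (.fv 0) (.nv 0)
  | .num, i + 1 => .nv i
  | .fn, i => .fv (i + 1)

/-- Formulas. The only primitive relation is equality of numbers. The logic is classical, so the
remaining connectives are abbreviations. -/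
inductive Formula : Type where
  | eq (t u : Term .num) : Formula
  | falsum : Formula
  | imp (φ ψ : Formula) : Formula
  /-- universal quantification over variable `0` of sort `s` -/
  | all (s : Srt) (φ : Formula) : Formula

namespace Formula

/-- `¬ φ` -/
def neg (φ : Formula) : Formula := φ.imp falsum

/-- `φ ∧ ψ` -/
def and (φ ψ : Formula) : Formula := (φ.imp ψ.neg).neg

/-- `φ ∨ ψ` -/
def or (φ ψ : Formula) : Formula := φ.neg.imp ψ

/-- Existential quantification over variable `0` of sort `s`. -/
def ex (s : Srt) (φ : Formula) : Formula := (all s φ.neg).neg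

/-- Capture-avoiding substitution in a formula. -/
def subst : Formula → Sub → Formula
  | eq t u, σ => eq (t.subst σ) (u.subst σ)
  | falsum, _ => falsum
  | imp φ ψ, σ => imp (φ.subst σ) (ψ.subst σ)
  | all s φ, σ => all s (φ.subst (σ.up s))

/-- A formula, moved under a binder of sort `s`. -/
def lift (φ : Formula) (s : Srt) : Formula := φ.subst fun r i => .var r (Ren.shift s r i)

/-- `φ(t)`, where `φ = φ(x)` and `x` is variable `0` of the sort of `t`. -/
def inst {s : Srt} (φ : Formula) (t : Term s) : Formula := φ.subst (Sub.single t)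

/-- Quantifier-free formulas (with arbitrary terms). -/
def QuantifierFree : Formula → Prop
  | eq _ _ => True
  | falsum => True
  | imp φ ψ => φ.QuantifierFree ∧ ψ.QuantifierFree
  | all _ _ => False

end Formula

open Term Formula

/-! ### Derivations -/

/-- Natural deduction for two-sorted classical predicate logic with equality of numbers, over the
axioms `T` (read as universally closed): `Deriv T Γ φ` says that `φ` is derivable from `T` and the
hypotheses `Γ`. -/
inductive Deriv (T : Formula → Prop) : List Formula → Formula → Prop where
  | ax {Γ : List Formula} {φ : Formula} : T φ → Deriv T Γ φ
  | hyp {Γ : List Formula} {φ : Formula} : φ ∈ Γ → Deriv T Γ φ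
  | impI {Γ : List Formula} {φ ψ : Formula} : Deriv T (φ :: Γ) ψ → Deriv T Γ (φ.imp ψ)
  | impE {Γ : List Formula} {φ ψ : Formula} : Deriv T Γ (φ.imp ψ) → Deriv T Γ φ → Deriv T Γ ψ
  /-- classical reductio ad absurdum -/
  | raa {Γ : List Formula} {φ : Formula} : Deriv T (φ.neg :: Γ) falsum → Deriv T Γ φ
  | allI {Γ : List Formula} {s : Srt} {φ : Formula} :
      Deriv T (Γ.map fun ψ => ψ.lift s) φ → Deriv T Γ (all s φ)
  | allE {Γ : List Formula} {s : Srt} {φ : Formula} (t : Term s) :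
      Deriv T Γ (all s φ) → Deriv T Γ (φ.inst t)
  | eqRefl {Γ : List Formula} (t : Term .num) : Deriv T Γ (eq t t)
  | eqSubst {Γ : List Formula} (φ : Formula) {t u : Term .num} :
      Deriv T Γ (eq t u) → Deriv T Γ (φ.inst t) → Deriv T Γ (φ.inst u)

/-- The (nonlogical) axioms of `RCA₀`. Free variables are parameters. -/
inductive RCA₀ : Formula → Prop where
  | succ_ne_zero (t : Term .num) : RCA₀ (neg (eq (succ t) zero))
  | succ_inj (t u : Term .num) : RCA₀ (imp (eq (succ t) (succ u)) (eq t u))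
  | add_zero (t : Term .num) : RCA₀ (eq (add t zero) t)
  | add_succ (t u : Term .num) : RCA₀ (eq (add t (succ u)) (succ (add t u)))
  | mul_zero (t : Term .num) : RCA₀ (eq (mul t zero) zero)
  | mul_succ (t u : Term .num) : RCA₀ (eq (mul t (succ u)) (add (mul t u) t))
  /-- `(λ x. t(x))(u) = t(u)` -/
  | beta (t u : Term .num) : RCA₀ (eq (app (lam t) u) (t.subst (Sub.single u)))
  | prec_zero (a b : Term .num) : RCA₀ (eq (prec a b zero) a)
  | prec_succ (a b t : Term .num) :
      RCA₀ (eq (prec a b (succ t)) (b.subst (Sub.double (prec a b t) t)))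
  /-- Extensionality: `∀ x, f(x) = g(x)` implies `t(f) = t(g)`. -/
  | ext (t : Term .num) (f g : Term .fn) :
      RCA₀ (imp (all .num (eq (app (f.lift .num) (nv 0)) (app (g.lift .num) (nv 0))))
        (eq (t.subst (Sub.single f)) (t.subst (Sub.single g))))
  /-- Quantifier-free induction: `φ(0) → (∀ x, φ(x) → φ(x + 1)) → ∀ x, φ(x)`. -/
  | ind (φ : Formula) (hφ : φ.QuantifierFree) :
      RCA₀ (imp (φ.inst zero) (imp (all .num (imp φ (φ.subst Sub.next))) (all .num φ)))
  /-- Quantifier-free choice: `(∀ x, ∃ y, φ(x, y)) → ∃ f, ∀ x, φ(x, f(x))`. -/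
  | choice (φ : Formula) (hφ : φ.QuantifierFree) :
      RCA₀ (imp (all .num (ex .num φ)) (ex .fn (all .num (φ.subst Sub.choice))))

/-- `φ` is provable from the axioms `T`. -/
def Provable (T : Formula → Prop) (φ : Formula) : Prop := Deriv T [] φ

/-! ### Some primitive recursive terms -/

/-- The term `1`. -/
def one : Term .num := succ zero

/-- Predecessor. -/
def pred (t : Term .num) : Term .num := prec zero (nv 1) t

/-- Truncated subtraction `t ∸ u`. -/
def monus (t u : Term .num) : Term .num := prec t (pred (nv 0)) u

/-- `2 ^ t` -/
def twoPow (t : Term .num) : Term .num := prec one (add (nv 0) (nv 0)) t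

/-- The triangular number `0 + 1 + ⋯ + t`. -/
def tri (t : Term .num) : Term .num := prec zero (add (nv 0) (succ (nv 1))) t

/-- The largest `w` with `tri w ≤ t`. -/
def triRoot (t : Term .num) : Term .num :=
  prec zero (add (nv 0) (monus one (monus (tri (succ (nv 0))) (succ (nv 1))))) t

/-- The Cantor pairing `⟨t, u⟩`, a bijection between pairs of numbers and numbers. -/
def pair (t u : Term .num) : Term .num := add (tri (add t u)) u

/-- `right ⟨t, u⟩ = u` -/
def right (t : Term .num) : Term .num := monus t (tri (triRoot t))

/-- `left ⟨t, u⟩ = t` -/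
def left (t : Term .num) : Term .num := monus (triRoot t) (right t)

/-- `t ≤ u` -/
def le (t u : Term .num) : Formula := eq (monus t u) zero

/-! ### Rational numbers

The number `⟨⟨a, b⟩, c⟩` codes the rational number `(a - b) / (c + 1)`. Every number is a code. -/

/-- The code of `(a - b) / (c + 1)`. -/
def qMk (a b c : Term .num) : Term .num := pair (pair a b) c

/-- The number `a` of a code. -/
def qPos (q : Term .num) : Term .num := left (left q)

/-- The number `b` of a code. -/
def qNeg (q : Term .num) : Term .num := right (left q)

/-- The denominator `c + 1` of a code. -/
def qDen (q : Term .num) : Term .num := succ (right q)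

/-- The sum of two coded rationals. -/
def qAdd (p q : Term .num) : Term .num :=
  qMk (add (mul (qPos p) (qDen q)) (mul (qPos q) (qDen p)))
    (add (mul (qNeg p) (qDen q)) (mul (qNeg q) (qDen p)))
    (pred (mul (qDen p) (qDen q)))

/-- The negative of a coded rational. -/
def qOpp (q : Term .num) : Term .num := qMk (qNeg q) (qPos q) (right q)

/-- The product of two coded rationals. -/
def qMul (p q : Term .num) : Term .num :=
  qMk (add (mul (qPos p) (qPos q)) (mul (qNeg p) (qNeg q)))
    (add (mul (qPos p) (qNeg q)) (mul (qNeg p) (qPos q)))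
    (pred (mul (qDen p) (qDen q)))

/-- `p ≤ q` for coded rationals. -/
def qLe (p q : Term .num) : Formula :=
  le (add (mul (qPos p) (qDen q)) (mul (qNeg q) (qDen p)))
    (add (mul (qPos q) (qDen p)) (mul (qNeg p) (qDen q)))

/-- The code of `t / 2 ^ k`. -/
def qDyadic (t k : Term .num) : Term .num := qMk t zero (pred (twoPow k))

/-- `|p - q| ≤ r` for coded rationals. -/
def qDistLe (p q r : Term .num) : Formula := and (qLe p (qAdd q r)) (qLe q (qAdd p r))

/-! ### Real numbers: quickly converging Cauchy sequences of rationals -/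

/-- `f` is a real number: a sequence of rationals with `|f(k) - f(k + i)| ≤ 2⁻ᵏ` for all `k, i`. -/
def isReal (f : Term .fn) : Formula :=
  let f' := (f.lift .num).lift .num
  all .num (all .num
    (qDistLe (app f' (nv 1)) (app f' (add (nv 1) (nv 0))) (qDyadic one (nv 1))))

/-- Equality of real numbers: `|f(k) - g(k)| ≤ 2 · 2⁻ᵏ` for all `k`. -/
def rEq (f g : Term .fn) : Formula :=
  all .num (qDistLe (app (f.lift .num) (nv 0)) (app (g.lift .num) (nv 0))
    (qDyadic (succ one) (nv 0)))

/-- The real number `0`. -/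
def rZero : Term .fn := lam (qMk zero zero zero)

/-- The real number `1`. -/
def rOne : Term .fn := lam (qMk one zero zero)

/-- Sum of real numbers: `k ↦ f(k + 1) + g(k + 1)`. -/
def rAdd (f g : Term .fn) : Term .fn :=
  lam (qAdd (app (f.lift .num) (succ (nv 0))) (app (g.lift .num) (succ (nv 0))))

/-- Negative of a real number. -/
def rOpp (f : Term .fn) : Term .fn := lam (qOpp (app (f.lift .num) (nv 0)))

/-- A natural number that is at least the absolute value of the coded rational `q`. -/
def qBound (q : Term .num) : Term .num := add (qPos q) (qNeg q)

/-- Product of real numbers: `k ↦ f(m + k) · g(m + k)` with an `m` such that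
`|f(0)| + |g(0)| + 2 ≤ 2ᵐ`. -/
def rMul (f g : Term .fn) : Term .fn :=
  let f' := f.lift .num
  let g' := g.lift .num
  let m := add (add (qBound (app f' zero)) (qBound (app g' zero))) (succ one)
  lam (qMul (app f' (add m (nv 0))) (app g' (add m (nv 0))))

/-! ### Complex numbers and `2 × 2` matrices -/

/-- A (term for a) complex number: its real part and its imaginary part. -/
structure CTerm where
  re : Term .fn
  im : Term .fn

def isComplex (z : CTerm) : Formula := and (isReal z.re) (isReal z.im)

def cEq (z w : CTerm) : Formula := and (rEq z.re w.re) (rEq z.im w.im)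

def cZero : CTerm := ⟨rZero, rZero⟩

def cOne : CTerm := ⟨rOne, rZero⟩

def cAdd (z w : CTerm) : CTerm := ⟨rAdd z.re w.re, rAdd z.im w.im⟩

def cMul (z w : CTerm) : CTerm :=
  ⟨rAdd (rMul z.re w.re) (rOpp (rMul z.im w.im)), rAdd (rMul z.re w.im) (rMul z.im w.re)⟩

/-- A (term for a) `2 × 2` matrix `(a b; c d)` of complex numbers. -/
structure MTerm where
  a : CTerm
  b : CTerm
  c : CTerm
  d : CTerm

def isMatrix (A : MTerm) : Formula :=
  and (and (isComplex A.a) (isComplex A.b)) (and (isComplex A.c) (isComplex A.d))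

def mEq (A B : MTerm) : Formula :=
  and (and (cEq A.a B.a) (cEq A.b B.b)) (and (cEq A.c B.c) (cEq A.d B.d))

def mOne : MTerm := ⟨cOne, cZero, cZero, cOne⟩

def mMul (A B : MTerm) : MTerm :=
  ⟨cAdd (cMul A.a B.a) (cMul A.b B.c), cAdd (cMul A.a B.b) (cMul A.b B.d),
   cAdd (cMul A.c B.a) (cMul A.d B.c), cAdd (cMul A.c B.b) (cMul A.d B.d)⟩

/-- `V` is the inverse of `U`. -/
def isInverse (U V : MTerm) : Formula := and (mEq (mMul U V) mOne) (mEq (mMul V U) mOne)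

/-- `J` consists of Jordan blocks: it is `(x 0; 0 y)`, that is, two blocks of size one, or it is
`(x 1; 0 x)`, that is, one block of size two. -/
def isJordan (J : MTerm) : Formula :=
  and (cEq J.c cZero) (or (cEq J.b cZero) (and (cEq J.b cOne) (cEq J.a J.d)))

/-- The matrix whose entries are given by the function variables `k, …, k + 7`. -/
def mVar (k : ℕ) : MTerm :=
  ⟨⟨fv k, fv (k + 1)⟩, ⟨fv (k + 2), fv (k + 3)⟩, ⟨fv (k + 4), fv (k + 5)⟩,
   ⟨fv (k + 6), fv (k + 7)⟩⟩

/-- Universal quantification over function variables `0, …, n - 1`. -/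
def allFn (n : ℕ) (φ : Formula) : Formula := (all .fn)^[n] φ

/-- Existential quantification over function variables `0, …, n - 1`. -/
def exFn (n : ℕ) (φ : Formula) : Formula := (ex .fn)^[n] φ

/-- The formula saying that the matrix `M` given by function variables `0, …, 7` has a Jordan
decomposition: there are `U`, `J` and `V = U⁻¹`, with `J` consisting of Jordan blocks, such that
`M = U J V`. Under the 24 quantifiers for the entries of `U`, `J`, `V`, the variables of `M` have the
indices `24, …, 31`. -/
def hasJordanDecomposition : Formula :=
  let U := mVar 0
  let J := mVar 8
  let V := mVar 16
  let M := mVar 24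
  exFn 24 (and (and (isMatrix U) (and (isMatrix J) (isMatrix V)))
    (and (isInverse U V) (and (isJordan J) (mEq M (mMul (mMul U J) V)))))

/-- The sentence saying that every `2 × 2` matrix of complex numbers has a Jordan decomposition. -/
def jordanSentence : Formula := allFn 8 (imp (isMatrix (mVar 0)) hasJordanDecomposition)

end RCA

/-!
By the completeness theorem, in the form that every consistent theory extends to a complete Henkin
theory, it suffices to show that every complete Henkin theory `T` extending `RCA₀` contains the
sentence. The numbers of such a `T` are the number terms modulo equality in `T`.

They form an ordered semiring with induction for quantifier-free properties, and the fractions of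
this semiring form an ordered field, the field of rational numbers of `T`. The sequences of rational
numbers given by function terms form a ring, which quantifier-free choice makes closed under
inverses and under approximate square roots. Hence the real numbers of `T`, as limits of such
sequences, form a formally real field in which every element or its negative has a square root.
Adjoining `√-1` to such a field gives a field in which every element has a square root. Over that
field the characteristic polynomial of a `2 × 2` matrix splits, so the matrix has a Jordan
decomposition. The case distinctions in its construction, such as whether the eigenvalues are equal,
are available because `T` is complete.
-/

namespace RCA

open Term Formula

/-! ### Substitution -/

/-- The substitution of variables for variables given by a renaming. -/
def Ren.toSub (ρ : Ren) : Sub := fun s i => .var s (ρ s i)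

/-- The identity substitution. -/
def Sub.id : Sub := .var

/-- Composition of substitutions: first `σ`, then `τ`. -/
def Sub.comp (σ τ : Sub) : Sub := fun s i => (σ s i).subst τ

/-- Assign `u` to variable `0` of sort `r` and the values of `σ` to the other variables. -/
def Sub.cons (σ : Sub) : {r : Srt} → Term r → Sub
  | .num, u, .num, 0 => u
  | .num, _, .num, i + 1 => σ .num i
  | .num, _, .fn, i => σ .fn i
  | .fn, _, .num, i => σ .num i
  | .fn, u, .fn, 0 => u
  | .fn, _, .fn, i + 1 => σ .fn i

theorem Sub.id_up (r : Srt) : Sub.id.up r = Sub.id := by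
  funext s i
  cases r <;> cases s <;> cases i <;> rfl

theorem Ren.toSub_up (ρ : Ren) (r : Srt) : ρ.toSub.up r = (ρ.up r).toSub := by
  funext s i
  cases r <;> cases s <;> cases i <;> rfl

theorem Sub.up_comp_ren_up (σ : Sub) (ρ : Ren) (r : Srt) :
    (fun s i => σ.up r s (ρ.up r s i)) = Sub.up (fun s i => σ s (ρ s i)) r := by
  funext s i
  cases r <;> cases s <;> cases i <;> rfl

@[simp] theorem Term.subst_id {s : Srt} (t : Term s) : t.subst Sub.id = t := by
  induction t with
  | var => rfl
  | _ => simp_all only [Term.subst, Sub.id_up]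

theorem Term.rename_eq_subst {s : Srt} (t : Term s) (ρ : Ren) :
    t.rename ρ = t.subst ρ.toSub := by
  induction t generalizing ρ <;> simp_all only [Term.rename, Term.subst, Ren.toSub_up, Ren.toSub]

theorem Term.rename_subst {s : Srt} (t : Term s) (ρ : Ren) (σ : Sub) :
    (t.rename ρ).subst σ = t.subst fun s i => σ s (ρ s i) := by
  induction t generalizing ρ σ <;> simp_all only [Term.rename, Term.subst, Sub.up_comp_ren_up]

theorem Term.rename_rename {s : Srt} (t : Term s) (ρ ρ' : Ren) :
    (t.rename ρ).rename ρ' = t.rename fun s i => ρ' s (ρ s i) := by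
  rw [Term.rename_eq_subst _ ρ', Term.rename_subst, Term.rename_eq_subst]
  rfl

theorem Term.rename_subst_eq_rename {s : Srt} (t : Term s) {ρ ρ' : Ren} {σ : Sub}
    (h : ∀ s i, σ s (ρ s i) = .var s (ρ' s i)) : (t.rename ρ).subst σ = t.rename ρ' := by
  rw [Term.rename_subst, Term.rename_eq_subst]
  congr 1
  exact funext₂ h

theorem Term.rename_subst_eq_self {s : Srt} (t : Term s) {ρ : Ren} {σ : Sub}
    (h : ∀ s i, σ s (ρ s i) = .var s i) : (t.rename ρ).subst σ = t := by
  rw [Term.rename_subst, show (fun s i => σ s (ρ s i)) = Sub.id from funext₂ h, Term.subst_id]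

theorem Term.lift_rename_up {s : Srt} (t : Term s) (ρ : Ren) (r : Srt) :
    (t.lift r).rename (ρ.up r) = (t.rename ρ).lift r := by
  simp only [Term.lift, Term.rename_rename]
  congr 1
  funext s i
  cases r <;> cases s <;> rfl

theorem Sub.up_rename_up (σ : Sub) (ρ : Ren) (r : Srt) :
    (fun s i => (σ.up r s i).rename (ρ.up r)) = Sub.up (fun s i => (σ s i).rename ρ) r := by
  funext s i
  cases r <;> cases s <;> cases i <;> first | rfl | exact Term.lift_rename_up _ _ _

theorem Term.subst_rename {s : Srt} (t : Term s) (σ : Sub) (ρ : Ren) :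
    (t.subst σ).rename ρ = t.subst fun s i => (σ s i).rename ρ := by
  induction t generalizing σ ρ <;> simp_all only [Term.rename, Term.subst, Sub.up_rename_up]

theorem Sub.up_shift (σ : Sub) (r s : Srt) (i : ℕ) :
    σ.up r s (Ren.shift r s i) = (σ s i).lift r := by
  cases r <;> cases s <;> rfl

@[simp] theorem Term.lift_subst_up {s : Srt} (t : Term s) (σ : Sub) (r : Srt) :
    (t.lift r).subst (σ.up r) = (t.subst σ).lift r := by
  simp only [Term.lift, Term.rename_subst, Term.subst_rename, Sub.up_shift]

theorem Sub.up_comp_up (σ τ : Sub) (r : Srt) : (σ.up r).comp (τ.up r) = (σ.comp τ).up r := by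
  funext s i
  cases r <;> cases s <;> cases i <;> first | rfl | exact Term.lift_subst_up _ _ _

theorem Term.subst_subst {s : Srt} (t : Term s) (σ τ : Sub) :
    (t.subst σ).subst τ = t.subst (σ.comp τ) := by
  induction t generalizing σ τ <;> simp_all only [Term.subst, Sub.up_comp_up, Sub.comp]

theorem Formula.subst_subst (φ : Formula) (σ τ : Sub) :
    (φ.subst σ).subst τ = φ.subst (σ.comp τ) := by
  induction φ generalizing σ τ <;>
    simp_all only [Formula.subst, Term.subst_subst, Sub.up_comp_up]

@[simp] theorem Formula.subst_id (φ : Formula) : φ.subst Sub.id = φ := by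
  induction φ <;> simp_all only [Formula.subst, Sub.id_up, Term.subst_id]

@[simp] theorem Term.lift_subst_single {s r : Srt} (t : Term s) (u : Term r) :
    (t.lift r).subst (Sub.single u) = t :=
  t.rename_subst_eq_self fun s i => by cases r <;> cases s <;> rfl

@[simp] theorem Term.lift_lift_subst_double {s : Srt} (x : Term s) (t u : Term .num) :
    ((x.lift .num).lift .num).subst (Sub.double t u) = x := by
  rw [Term.lift, Term.lift, Term.rename_rename]
  exact x.rename_subst_eq_self fun s i => by cases s <;> rfl

theorem Term.lift_subst_next {s : Srt} (x : Term s) :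
    (x.lift .num).subst Sub.next = x.lift .num :=
  x.rename_subst_eq_rename fun s i => by cases s <;> rfl

theorem Term.lift_lift_subst_choice {s : Srt} (x : Term s) :
    ((x.lift .num).lift .num).subst Sub.choice = (x.lift .fn).lift .num := by
  simp only [Term.lift, Term.rename_rename]
  exact x.rename_subst_eq_rename fun s i => by cases s <;> rfl

theorem Sub.up_comp_single (σ : Sub) {r : Srt} (u : Term r) :
    (σ.up r).comp (Sub.single u) = σ.cons u := by
  funext s i
  cases r <;> cases s <;> cases i <;> first | rfl | exact Term.lift_subst_single _ _

theorem Sub.single_comp (σ : Sub) {r : Srt} (u : Term r) :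
    (Sub.single u).comp σ = σ.cons (u.subst σ) := by
  funext s i
  cases r <;> cases s <;> cases i <;> rfl

theorem Sub.single_cons (t u : Term .num) : (Sub.single u).cons t = Sub.double t u := by
  funext s i
  rcases s, i with ⟨_ | _, _ | _ | i⟩ <;> rfl

theorem Sub.single_lift_comp_single (t u : Term .num) :
    (Sub.single (t.lift .num)).comp (Sub.single u) = Sub.double t u := by
  rw [Sub.single_comp, Term.lift_subst_single, Sub.single_cons]

theorem Sub.double_comp (t u : Term .num) (σ : Sub) :
    (Sub.double t u).comp σ =
      ((σ.up .num).up .num).comp (Sub.double (t.subst σ) (u.subst σ)) := by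
  funext s i
  match s, i with
  | .num, 0 | .num, 1 => rfl
  | .num, i + 2 | .fn, i => exact (Term.lift_lift_subst_double _ _ _).symm

theorem Sub.next_comp_up (σ : Sub) : Sub.next.comp (σ.up .num) = (σ.up .num).comp Sub.next := by
  funext s i
  match s, i with
  | .num, 0 => rfl
  | .num, i + 1 | .fn, i => exact (Term.lift_subst_next _).symm

theorem Sub.next_comp_single (t : Term .num) :
    Sub.next.comp (Sub.single t) = Sub.single (succ t) := by
  funext s i
  cases s <;> cases i <;> rfl

theorem Sub.choice_comp_up_up (σ : Sub) :
    Sub.choice.comp ((σ.up .fn).up .num) = ((σ.up .num).up .num).comp Sub.choice := by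
  funext s i
  match s, i with
  | .num, 0 | .num, 1 => rfl
  | .num, i + 2 | .fn, i => exact (Term.lift_lift_subst_choice _).symm

theorem Sub.choice_comp_cons_single (f : Term .fn) (t : Term .num) :
    Sub.choice.comp ((Sub.single f).cons t) = Sub.double (.app f t) t := by
  funext s i
  match s, i with
  | .num, 0 | .num, 1 | .num, _ + 2 | .fn, _ => rfl

theorem Term.subst_up_subst_single {s : Srt} (t : Term s) (σ : Sub) {r : Srt} (u : Term r) :
    (t.subst (σ.up r)).subst (Sub.single u) = t.subst (σ.cons u) := by
  rw [Term.subst_subst, Sub.up_comp_single]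

theorem Formula.subst_up_inst (φ : Formula) (σ : Sub) {r : Srt} (u : Term r) :
    (φ.subst (σ.up r)).inst u = φ.subst (σ.cons u) := by
  rw [Formula.inst, Formula.subst_subst, Sub.up_comp_single]

theorem Term.subst_single_subst {s r : Srt} (t : Term s) (u : Term r) (σ : Sub) :
    (t.subst (Sub.single u)).subst σ = (t.subst (σ.up r)).subst (Sub.single (u.subst σ)) := by
  rw [Term.subst_up_subst_single, Term.subst_subst, Sub.single_comp]

theorem Formula.inst_subst (φ : Formula) {r : Srt} (u : Term r) (σ : Sub) :
    (φ.inst u).subst σ = (φ.subst (σ.up r)).inst (u.subst σ) := by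
  rw [Formula.subst_up_inst, Formula.inst, Formula.subst_subst, Sub.single_comp]

theorem Formula.subst_next_inst (φ : Formula) (t : Term .num) :
    (φ.subst Sub.next).inst t = φ.inst (succ t) := by
  rw [Formula.inst, Formula.subst_subst, Sub.next_comp_single, Formula.inst]

theorem Formula.lift_subst_up (φ : Formula) (σ : Sub) (r : Srt) :
    (φ.lift r).subst (σ.up r) = (φ.subst σ).lift r := by
  rw [Formula.lift, Formula.lift, Formula.subst_subst, Formula.subst_subst]
  congr 1
  funext s i
  exact (σ.up_shift r s i).trans (Term.rename_eq_subst _ _)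

theorem Formula.QuantifierFree.subst {φ : Formula} (h : φ.QuantifierFree) (σ : Sub) :
    (φ.subst σ).QuantifierFree := by
  induction φ with
  | eq | falsum => trivial
  | imp φ ψ hφ hψ => exact ⟨hφ h.1, hψ h.2⟩
  | all => exact h.elim

theorem RCA₀.subst {φ : Formula} (h : RCA₀ φ) (σ : Sub) : RCA₀ (φ.subst σ) := by
  cases h with
  | succ_ne_zero => exact .succ_ne_zero _
  | succ_inj => exact .succ_inj _ _
  | add_zero => exact .add_zero _
  | add_succ => exact .add_succ _ _
  | mul_zero => exact .mul_zero _
  | mul_succ => exact .mul_succ _ _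
  | beta t u =>
    simp only [Formula.subst, Term.subst, Term.subst_single_subst]
    exact .beta _ _
  | prec_zero => exact .prec_zero _ _
  | prec_succ a b t =>
    simp only [Formula.subst, Term.subst, Term.subst_subst b, Sub.double_comp]
    simpa only [Term.subst, Term.subst_subst] using
      RCA₀.prec_succ (a.subst σ) (b.subst ((σ.up .num).up .num)) (t.subst σ)
  | ext t f g =>
    simpa only [Formula.subst, Term.subst, Term.subst_single_subst, Term.lift_subst_up, Sub.up]
      using RCA₀.ext (t.subst (σ.up .fn)) (f.subst σ) (g.subst σ)
  | ind φ hφ =>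
    simpa only [Formula.subst, Term.subst, Formula.inst_subst, Formula.subst_subst,
      Sub.next_comp_up] using RCA₀.ind (φ.subst (σ.up .num)) (hφ.subst _)
  | choice φ hφ =>
    simpa only [Formula.subst, Formula.ex, Formula.neg, Formula.subst_subst,
      Sub.choice_comp_up_up] using RCA₀.choice (φ.subst ((σ.up .num).up .num)) (hφ.subst _)

/-! ### Derivations -/

theorem Deriv.weaken {T : Formula → Prop} {Γ Δ : List Formula} {φ : Formula} (h : Deriv T Γ φ)
    (hΓ : Γ ⊆ Δ) : Deriv T Δ φ := by
  induction h generalizing Δ with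
  | ax h => exact .ax h
  | hyp h => exact .hyp (hΓ h)
  | impI _ ih => exact .impI (ih (List.cons_subset_cons _ hΓ))
  | impE _ _ ih₁ ih₂ => exact .impE (ih₁ hΓ) (ih₂ hΓ)
  | raa _ ih => exact .raa (ih (List.cons_subset_cons _ hΓ))
  | allI _ ih => exact .allI (ih (List.map_subset _ hΓ))
  | allE t _ ih => exact .allE t (ih hΓ)
  | eqRefl t => exact .eqRefl t
  | eqSubst φ _ _ ih₁ ih₂ => exact .eqSubst φ (ih₁ hΓ) (ih₂ hΓ)

theorem Deriv.subst {T : Formula → Prop} (hT : ∀ φ, T φ → ∀ σ, T (φ.subst σ)) {Γ : List Formula}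
    {φ : Formula} (h : Deriv T Γ φ) (σ : Sub) :
    Deriv T (Γ.map fun ψ => ψ.subst σ) (φ.subst σ) := by
  induction h generalizing σ with
  | ax h => exact .ax (hT _ h σ)
  | hyp h => exact .hyp (List.mem_map_of_mem h)
  | impI _ ih => exact .impI (ih σ)
  | impE _ _ ih₁ ih₂ => exact .impE (ih₁ σ) (ih₂ σ)
  | raa _ ih => exact .raa (ih σ)
  | @allI Γ s φ _ ih =>
    refine .allI ?_
    simpa only [List.map_map, Function.comp_def, Formula.lift_subst_up] using ih (σ.up s)
  | allE t _ ih =>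
    rw [Formula.inst_subst]
    exact .allE _ (ih σ)
  | eqRefl t => exact .eqRefl _
  | eqSubst φ _ _ ih₁ ih₂ =>
    rw [Formula.inst_subst]
    exact .eqSubst _ (ih₁ σ) (Formula.inst_subst .. ▸ ih₂ σ)

theorem Deriv.cut {T : Formula → Prop} {Γ : List Formula} {φ ψ : Formula} (h : Deriv T Γ φ)
    (h' : Deriv T (φ :: Γ) ψ) : Deriv T Γ ψ :=
  .impE (.impI h') h

/-- A strict bound for the indices of all variables of a term, including the bound ones. -/
def Term.bound : {s : Srt} → Term s → ℕ
  | _, .var _ i => i + 1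
  | _, .zero => 0
  | _, .succ t => t.bound
  | _, .add t u => max t.bound u.bound
  | _, .mul t u => max t.bound u.bound
  | _, .app f t => max f.bound t.bound
  | _, .lam t => t.bound
  | _, .prec a b t => max a.bound (max b.bound t.bound)

/-- A strict bound for the indices of all variables of a formula, including the bound ones. -/
def Formula.bound : Formula → ℕ
  | eq t u => max t.bound u.bound
  | falsum => 0
  | imp φ ψ => max φ.bound ψ.bound
  | all _ φ => φ.bound

theorem Sub.up_congr {σ τ : Sub} {n : ℕ} (h : ∀ s, ∀ i < n, σ s i = τ s i) (r : Srt) :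
    ∀ s, ∀ i < n, σ.up r s i = τ.up r s i := by
  intro s i hi
  cases r <;> cases s <;> cases i <;> simp only [Sub.up] <;> congr 1 <;> exact h _ _ (by lia)

theorem Term.subst_congr {s : Srt} (t : Term s) {σ τ : Sub}
    (h : ∀ s, ∀ i < t.bound, σ s i = τ s i) : t.subst σ = t.subst τ := by
  induction t generalizing σ τ with
  | var s i => exact h s i i.lt_succ_self
  | zero => rfl
  | succ t ih => exact congrArg succ (ih h)
  | lam t ih => exact congrArg lam (ih (Sub.up_congr h _))
  | add t u iht ihu | mul t u iht ihu | app t u iht ihu =>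
    simp only [Term.bound, lt_max_iff] at h
    rw [Term.subst, Term.subst, iht fun s i hi => h s i (.inl hi),
      ihu fun s i hi => h s i (.inr hi)]
  | prec a b t iha ihb iht =>
    simp only [Term.bound, lt_max_iff] at h
    rw [Term.subst, Term.subst, iha fun s i hi => h s i (.inl hi),
      ihb (Sub.up_congr (Sub.up_congr (fun s i hi => h s i (.inr (.inl hi))) _) _),
      iht fun s i hi => h s i (.inr (.inr hi))]

theorem Formula.subst_congr (φ : Formula) {σ τ : Sub}
    (h : ∀ s, ∀ i < φ.bound, σ s i = τ s i) : φ.subst σ = φ.subst τ := by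
  induction φ generalizing σ τ with
  | eq t u =>
    simp only [Formula.bound, lt_max_iff] at h
    rw [Formula.subst, Formula.subst, t.subst_congr fun s i hi => h s i (.inl hi),
      u.subst_congr fun s i hi => h s i (.inr hi)]
  | falsum => rfl
  | imp φ ψ ihφ ihψ =>
    simp only [Formula.bound, lt_max_iff] at h
    rw [Formula.subst, Formula.subst, ihφ fun s i hi => h s i (.inl hi),
      ihψ fun s i hi => h s i (.inr hi)]
  | all r φ ih => exact congrArg (Formula.all r) (ih (Sub.up_congr h r))

/-- The substitution that turns variable `n` of the given sort into the bound variable `0`, making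
room for it as `Ren.shift` does. -/
def Sub.abstract (n : ℕ) : Srt → Sub
  | .num, .num, i => if i = n then .nv 0 else .nv (i + 1)
  | .num, .fn, i => .fv i
  | .fn, .num, i => .nv i
  | .fn, .fn, i => if i = n then .fv 0 else .fv (i + 1)

theorem Sub.abstract_of_ne {n i : ℕ} (hi : i ≠ n) (s r : Srt) :
    Sub.abstract n s r i = .var r (Ren.shift s r i) := by
  cases s <;> cases r <;> simp [Sub.abstract, Ren.shift, hi]

theorem Sub.single_var_comp_abstract {n i : ℕ} (hi : i < n) (s r : Srt) :
    (Sub.single (.var s n)).comp (Sub.abstract n s) r i = .var r i := by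
  cases s <;> cases r <;> cases i <;> simp [Sub.comp, Sub.single, Term.subst, Sub.abstract] <;> lia

theorem Formula.inst_var_subst_abstract {φ : Formula} {n : ℕ} (hφ : φ.bound ≤ n) (s : Srt) :
    (φ.inst (.var s n)).subst (Sub.abstract n s) = φ := by
  conv_rhs => rw [← φ.subst_id]
  rw [Formula.inst, Formula.subst_subst]
  exact φ.subst_congr fun r i hi => Sub.single_var_comp_abstract (hi.trans_le hφ) s r

theorem Formula.subst_abstract {φ : Formula} {n : ℕ} (hφ : φ.bound ≤ n) (s : Srt) :
    φ.subst (Sub.abstract n s) = φ.lift s :=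
  φ.subst_congr fun r _ hi => Sub.abstract_of_ne (hi.trans_le hφ).ne s r

theorem Deriv.all_of_inst_var {T : Formula → Prop} (hT : ∀ φ, T φ → ∀ σ, T (φ.subst σ))
    {Γ : List Formula} {s : Srt} {ψ : Formula} {n : ℕ} (hΓ : ∀ χ ∈ Γ, χ.bound ≤ n)
    (hψ : ψ.bound ≤ n) (h : Deriv T Γ (ψ.inst (.var s n))) : Deriv T Γ (all s ψ) := by
  have h' := h.subst hT (Sub.abstract n s)
  rw [Formula.inst_var_subst_abstract hψ,
    List.map_congr_left fun χ hχ => Formula.subst_abstract (hΓ χ hχ) s] at h'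
  exact .allI h'

theorem Deriv.exists_all_of_inst {T : Formula → Prop} (hT : ∀ φ, T φ → ∀ σ, T (φ.subst σ))
    (Γ : List Formula) (s : Srt) (ψ : Formula) :
    ∃ t : Term s, Deriv T Γ (ψ.inst t) → Deriv T Γ (all s ψ) := by
  obtain ⟨n, hn⟩ := ((ψ :: Γ).finite_toSet.image Formula.bound).bddAbove
  have hbound : ∀ χ ∈ ψ :: Γ, χ.bound ≤ n := fun χ hχ => hn ⟨χ, hχ, rfl⟩
  exact ⟨.var s n, Deriv.all_of_inst_var hT (fun χ hχ => hbound χ (.tail _ hχ))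
    (hbound ψ (.head _))⟩

/-! ### Countability of the language -/

/-- An injective numbering of the terms. -/
def Term.code : {s : Srt} → Term s → ℕ
  | _, .var .num i => Nat.pair 0 i
  | _, .var .fn i => Nat.pair 1 i
  | _, .zero => Nat.pair 2 0
  | _, .succ t => Nat.pair 3 t.code
  | _, .add t u => Nat.pair 4 (Nat.pair t.code u.code)
  | _, .mul t u => Nat.pair 5 (Nat.pair t.code u.code)
  | _, .app t u => Nat.pair 6 (Nat.pair t.code u.code)
  | _, .lam t => Nat.pair 7 t.code
  | _, .prec a b t => Nat.pair 8 (Nat.pair a.code (Nat.pair b.code t.code))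

/-- An injective numbering of the formulas. -/
def Formula.code : Formula → ℕ
  | .eq t u => Nat.pair 0 (Nat.pair t.code u.code)
  | .falsum => Nat.pair 1 0
  | .imp φ ψ => Nat.pair 2 (Nat.pair φ.code ψ.code)
  | .all .num φ => Nat.pair 3 φ.code
  | .all .fn φ => Nat.pair 4 φ.code

theorem Term.code_injective {s : Srt} : Function.Injective (Term.code (s := s)) := by
  intro t
  induction t with
  | var s i => cases s <;> rintro ⟨⟩ h <;> simp_all [Term.code, Nat.pair_eq_pair]
  | _ => rintro ⟨⟩ h <;> grind [Term.code, Nat.pair_eq_pair]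

theorem Formula.code_injective : Function.Injective Formula.code := by
  intro φ
  induction φ with
  | eq t u => rintro (_ | _ | _ | ⟨_ | _, _⟩) h <;>
      grind [Formula.code, Nat.pair_eq_pair, Term.code_injective.eq_iff]
  | all s φ ih => cases s <;> rintro (_ | _ | _ | ⟨_ | _, _⟩) h <;>
      grind [Formula.code, Nat.pair_eq_pair]
  | _ => rintro (_ | _ | _ | ⟨_ | _, _⟩) h <;> grind [Formula.code, Nat.pair_eq_pair]

instance : Countable Formula := Formula.code_injective.countable

instance : Nonempty Formula := ⟨.falsum⟩

/-! ### Henkin theories -/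

/-- A set of formulas that behaves like the set of all formulas that are true in a model of the
axioms `A`, all of whose objects are denoted by terms. -/
structure Henkin (A T : Formula → Prop) : Prop where
  falsum : ¬T .falsum
  imp {φ ψ : Formula} : T (.imp φ ψ) ↔ (T φ → T ψ)
  all {s : Srt} {φ : Formula} : T (.all s φ) ↔ ∀ t : Term s, T (φ.inst t)
  ax {φ : Formula} : A φ → T φ
  refl (t : Term .num) : T (.eq t t)
  eqSubst (φ : Formula) {t u : Term .num} : T (.eq t u) → T (φ.inst t) → T (φ.inst u)

/-- No contradiction is derivable from the axioms `A` and finitely many members of `T`. -/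
def Consistent (A T : Formula → Prop) : Prop :=
  ∀ Γ : List Formula, (∀ φ ∈ Γ, T φ) → ¬Deriv A Γ .falsum

/-- The set `T` contains `φ`, or it contains `¬ φ` and, if `φ` is a universal statement, also the
negation of one of its instances. -/
def Decides (T : Formula → Prop) (φ : Formula) : Prop :=
  T φ ∨ T φ.neg ∧ ∀ s ψ, φ = .all s ψ → ∃ t : Term s, T (ψ.inst t).neg

theorem Decides.mono {T T' : Formula → Prop} {φ : Formula} (h : Decides T φ)
    (hT : ∀ ψ, T ψ → T' ψ) : Decides T' φ :=
  h.imp (hT _) fun ⟨hφ, hw⟩ => ⟨hT _ hφ, fun s ψ e => (hw s ψ e).imp fun _ => hT _⟩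

theorem exists_decides_of_not_deriv {A : Formula → Prop} (hA : ∀ φ, A φ → ∀ σ, A (φ.subst σ))
    {Γ : List Formula} (hΓ : ¬Deriv A Γ .falsum) (φ : Formula) :
    ∃ Δ, ¬Deriv A Δ .falsum ∧ Γ ⊆ Δ ∧ Decides (· ∈ Δ) φ := by
  by_cases h : Deriv A (φ :: Γ) .falsum
  · have hneg : Deriv A Γ φ.neg := .impI h
    by_cases hφ : ∃ s ψ, φ = .all s ψ
    · obtain ⟨s, ψ, rfl⟩ := hφ
      obtain ⟨t, ht⟩ := Deriv.exists_all_of_inst hA Γ s ψ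
      refine ⟨(Formula.all s ψ).neg :: (ψ.inst t).neg :: Γ, fun hΔ => hΓ ?_, by simp,
        .inr ⟨by simp, ?_⟩⟩
      · exact hneg.impE (ht (.raa ((hneg.weaken (by simp)).cut hΔ)))
      · rintro _ _ ⟨⟩
        exact ⟨t, by simp⟩
    · exact ⟨φ.neg :: Γ, fun hΔ => hΓ (hneg.cut hΔ), by simp,
        .inr ⟨by simp, fun s ψ e => (hφ ⟨s, ψ, e⟩).elim⟩⟩
  · exact ⟨φ :: Γ, h, by simp, .inl (by simp)⟩

theorem Consistent.exists_mem {A : Formula → Prop} {G : ℕ → List Formula}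
    (hG : Monotone fun n => {φ | φ ∈ G n}) (hA : ∀ n, ¬Deriv A (G n) .falsum) :
    Consistent A fun φ => ∃ n, φ ∈ G n := by
  intro Γ hΓ h
  have hsub : ∃ n, Γ ⊆ G n := by
    clear h
    induction Γ with
    | nil => exact ⟨0, List.nil_subset _⟩
    | cons φ Γ ih =>
      obtain ⟨⟨m, hm⟩, hΓ⟩ := List.forall_mem_cons.1 hΓ
      obtain ⟨n, hn⟩ := ih hΓ
      exact ⟨max m n, List.cons_subset.2
        ⟨hG (le_max_left m n) hm, fun ψ hψ => hG (le_max_right m n) (hn hψ)⟩⟩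
  obtain ⟨n, hn⟩ := hsub
  exact hA n (h.weaken hn)

/-- Lindenbaum's lemma, with witnesses. -/
theorem exists_consistent_forall_decides {A : Formula → Prop}
    (hA : ∀ φ, A φ → ∀ σ, A (φ.subst σ)) {Γ : List Formula} (hΓ : ¬Deriv A Γ .falsum) :
    ∃ T, Consistent A T ∧ (∀ φ ∈ Γ, T φ) ∧ ∀ φ, Decides T φ := by
  obtain ⟨e, he⟩ := exists_surjective_nat Formula
  choose next next_consistent subset_next next_decides using
    fun (Δ : {Δ // ¬Deriv A Δ .falsum}) (φ : Formula) => exists_decides_of_not_deriv hA Δ.2 φ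
  let G : ℕ → {Δ // ¬Deriv A Δ .falsum} :=
    Nat.rec ⟨Γ, hΓ⟩ fun n Δ => ⟨next Δ (e n), next_consistent Δ (e n)⟩
  refine ⟨fun φ => ∃ n, φ ∈ (G n).1, ?_, fun φ hφ => ⟨0, hφ⟩, he.forall.2 fun n => ?_⟩
  · exact .exists_mem (monotone_nat_of_le_succ fun n => subset_next (G n) (e n)) fun n => (G n).2
  · exact (next_decides (G n) (e n)).mono fun φ hφ => ⟨n + 1, hφ⟩

section

variable {A T : Formula → Prop} (hT : Consistent A T) (hdec : ∀ φ, Decides T φ)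
include hT

theorem Consistent.not_neg {φ : Formula} (h : T φ) : ¬T φ.neg := fun h' =>
  hT [φ.neg, φ] (by simp [h, h']) (.impE (.hyp (φ := φ.neg) (by simp)) (.hyp (by simp)))

include hdec

theorem Consistent.mem_of_deriv {Γ : List Formula} {φ : Formula} (hΓ : ∀ ψ ∈ Γ, T ψ)
    (h : Deriv A Γ φ) : T φ := by
  refine (hdec φ).resolve_right fun ⟨hφ, _⟩ => ?_
  exact hT (φ.neg :: Γ) (by simpa [hφ] using hΓ)
    (.impE (.hyp (φ := φ.neg) (by simp)) (h.weaken (by simp)))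

theorem Consistent.imp_iff {φ ψ : Formula} : T (.imp φ ψ) ↔ (T φ → T ψ) := by
  refine ⟨fun h hφ => ?_, fun h => ?_⟩
  · exact hT.mem_of_deriv hdec (Γ := [φ.imp ψ, φ]) (by simp [h, hφ])
      (.impE (.hyp (φ := φ.imp ψ) (by simp)) (.hyp (by simp)))
  · obtain hφ | ⟨hφ, -⟩ := hdec φ
    · exact hT.mem_of_deriv hdec (Γ := [ψ]) (by simp [h hφ]) (.impI (.hyp (by simp)))
    · exact hT.mem_of_deriv hdec (Γ := [φ.neg]) (by simp [hφ])
        (.impI (.raa (.impE (.hyp (φ := φ.neg) (by simp)) (.hyp (by simp)))))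

theorem Consistent.all_iff {s : Srt} {φ : Formula} :
    T (.all s φ) ↔ ∀ t : Term s, T (φ.inst t) := by
  refine ⟨fun h t => ?_, fun h => (hdec _).resolve_right fun ⟨_, hw⟩ => ?_⟩
  · exact hT.mem_of_deriv hdec (Γ := [.all s φ]) (by simp [h]) (.allE t (.hyp (by simp)))
  · obtain ⟨t, ht⟩ := hw s φ rfl
    exact hT.not_neg (h t) ht

theorem Consistent.henkin : Henkin A T where
  falsum h := hT [.falsum] (by simp [h]) (.hyp (by simp))
  imp := hT.imp_iff hdec
  all := hT.all_iff hdec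
  ax h := hT.mem_of_deriv hdec (Γ := []) (by simp) (.ax h)
  refl t := hT.mem_of_deriv hdec (Γ := []) (by simp) (.eqRefl t)
  eqSubst φ t u h h' := hT.mem_of_deriv hdec (Γ := [.eq t u, φ.inst t]) (by simp [h, h'])
    (.eqSubst φ (t := t) (.hyp (by simp)) (.hyp (by simp)))

end

theorem Provable.of_henkin {A : Formula → Prop} (hA : ∀ φ, A φ → ∀ σ, A (φ.subst σ)) {χ : Formula}
    (hχ : ∀ T, Henkin A T → T χ) : Provable A χ := by
  by_contra h
  obtain ⟨T, hT, hneg, hdec⟩ :=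
    exists_consistent_forall_decides hA (Γ := [χ.neg]) fun h' => h (.raa h')
  exact hT.not_neg (hχ T (hT.henkin hdec)) (hneg _ (by simp))

namespace Henkin

variable {A T : Formula → Prop} (hT : Henkin A T)
include hT

theorem neg_iff {φ : Formula} : T φ.neg ↔ ¬T φ := by
  rw [Formula.neg, hT.imp]
  exact imp_congr_right fun _ => iff_false_intro hT.falsum

theorem and_iff {φ ψ : Formula} : T (φ.and ψ) ↔ T φ ∧ T ψ := by
  rw [Formula.and, hT.neg_iff, hT.imp, hT.neg_iff, Classical.not_imp, not_not]

theorem or_iff {φ ψ : Formula} : T (φ.or ψ) ↔ T φ ∨ T ψ := by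
  rw [Formula.or, hT.imp, hT.neg_iff, or_iff_not_imp_left]

theorem ex_iff {s : Srt} {φ : Formula} : T (φ.ex s) ↔ ∃ t : Term s, T (φ.inst t) := by
  rw [Formula.ex, hT.neg_iff, hT.all, not_forall]
  refine exists_congr fun t => ?_
  change ¬T (φ.inst t).neg ↔ _
  rw [hT.neg_iff, not_not]

end Henkin

/-! ### The numbers of a Henkin theory -/

/-- Replace number variables `0` and `1` by `t` and `u`, and keep the other variables. -/
def Sub.update₂ (t u : Term .num) : Sub
  | .num, 0 => t
  | .num, 1 => u
  | .num, i + 2 => .nv (i + 2)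
  | .fn, i => .fv i

theorem Sub.update₂_comp_double (s s' t u : Term .num) :
    (Sub.update₂ s s').comp (Sub.double t u) =
      Sub.double (s.subst (Sub.double t u)) (s'.subst (Sub.double t u)) := by
  funext s i
  match s, i with
  | .num, 0 | .num, 1 | .num, _ + 2 | .fn, _ => rfl

namespace Henkin

variable {T : Formula → Prop} (hT : Henkin RCA₀ T)

section
include hT

theorem eq_subst_single (s : Term .num) {t u : Term .num} (h : T (.eq t u)) :
    T (.eq (s.subst (Sub.single t)) (s.subst (Sub.single u))) := by
  have := hT.eqSubst (.eq ((s.subst (Sub.single t)).lift .num) s) h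
  simp only [Formula.inst, Formula.subst, Term.lift_subst_single] at this
  exact this (hT.refl _)

theorem eq_symm {t u : Term .num} (h : T (.eq t u)) : T (.eq u t) := by
  have := hT.eqSubst (.eq (nv 0) (t.lift .num)) h
  simp only [Formula.inst, Formula.subst, Term.lift_subst_single] at this
  exact this (hT.refl _)

theorem eq_trans {t u v : Term .num} (h : T (.eq t u)) (h' : T (.eq u v)) : T (.eq t v) := by
  have := hT.eqSubst (.eq (t.lift .num) (nv 0)) h'
  simp only [Formula.inst, Formula.subst, Term.lift_subst_single] at this
  exact this h

theorem eq_subst_double (s : Term .num) {t t' u u' : Term .num} (ht : T (.eq t t'))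
    (hu : T (.eq u u')) : T (.eq (s.subst (Sub.double t u)) (s.subst (Sub.double t' u'))) := by
  have h := hT.eq_subst_single (s.subst ((Sub.single u).up .num)) ht
  have h' := hT.eq_subst_single (s.subst (Sub.single (t'.lift .num))) hu
  rw [Term.subst_up_subst_single, Term.subst_up_subst_single, Sub.single_cons,
    Sub.single_cons] at h
  rw [Term.subst_subst, Term.subst_subst, Sub.single_lift_comp_single,
    Sub.single_lift_comp_single] at h'
  exact hT.eq_trans h h'

end

/-- Equality of number terms in the theory. -/
def setoid : Setoid (Term .num) :=
  ⟨fun t u => T (.eq t u), hT.refl, hT.eq_symm, hT.eq_trans⟩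

/-- The numbers of the term model. -/
def Num : Type := Quotient hT.setoid

/-- The number denoted by a term. -/
def den (t : Term .num) : hT.Num := Quotient.mk hT.setoid t

theorem eq_iff {t u : Term .num} : T (.eq t u) ↔ hT.den t = hT.den u :=
  (Quotient.eq (r := hT.setoid)).symm

theorem den_surjective : Function.Surjective hT.den := Quotient.exists_rep

theorem den_eq_of_rca {t u : Term .num} (h : RCA₀ (.eq t u)) : hT.den t = hT.den u :=
  hT.eq_iff.1 (hT.ax h)

/-- The binary function defined by a term with number variables `0` and `1`. -/
def map₂ (s : Term .num) : hT.Num → hT.Num → hT.Num :=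
  Quotient.map₂ (fun t u => s.subst (Sub.double t u)) fun _ _ ht _ _ hu =>
    hT.eq_subst_double s ht hu

theorem map₂_den (s t u : Term .num) :
    hT.map₂ s (hT.den t) (hT.den u) = hT.den (s.subst (Sub.double t u)) := rfl

instance : Zero hT.Num := ⟨hT.den zero⟩
instance : One hT.Num := ⟨hT.den one⟩
instance : Add hT.Num := ⟨hT.map₂ (add (nv 0) (nv 1))⟩
instance : Mul hT.Num := ⟨hT.map₂ (mul (nv 0) (nv 1))⟩
instance : _root_.Sub hT.Num := ⟨hT.map₂ (monus (nv 0) (nv 1))⟩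

/-- Powers of `2` in the term model. -/
def twoPow (x : hT.Num) : hT.Num := hT.map₂ (RCA.twoPow (nv 0)) x x

/-- Triangular numbers in the term model. -/
def tri (x : hT.Num) : hT.Num := hT.map₂ (RCA.tri (nv 0)) x x

/-- The index of the largest triangular number below a given number of the term model. -/
def triRoot (x : hT.Num) : hT.Num := hT.map₂ (RCA.triRoot (nv 0)) x x

/-- The function on the numbers of the term model that is denoted by a term. -/
def app (f : Term .fn) (x : hT.Num) : hT.Num :=
  hT.map₂ (.app ((f.lift .num).lift .num) (nv 0)) x x

theorem den_zero : hT.den zero = 0 := rfl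
theorem den_one : hT.den one = 1 := rfl
theorem den_add (t u : Term .num) : hT.den (add t u) = hT.den t + hT.den u := rfl
theorem den_mul (t u : Term .num) : hT.den (mul t u) = hT.den t * hT.den u := rfl
theorem den_monus (t u : Term .num) : hT.den (monus t u) = hT.den t - hT.den u := rfl
theorem den_twoPow (t : Term .num) : hT.den (RCA.twoPow t) = hT.twoPow (hT.den t) := rfl
theorem den_tri (t : Term .num) : hT.den (RCA.tri t) = hT.tri (hT.den t) := rfl
theorem den_triRoot (t : Term .num) : hT.den (RCA.triRoot t) = hT.triRoot (hT.den t) := rfl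

theorem den_app (f : Term .fn) (t : Term .num) : hT.den (.app f t) = hT.app f (hT.den t) := by
  rw [app, map₂_den, Term.subst, Term.lift_lift_subst_double]
  rfl

theorem den_succ (t : Term .num) : hT.den (succ t) = hT.den t + 1 := by
  have h : hT.den (add t zero) = hT.den t := hT.den_eq_of_rca (.add_zero t)
  calc hT.den (succ t) = hT.map₂ (succ (nv 0)) (hT.den t) 0 := rfl
    _ = hT.map₂ (succ (nv 0)) (hT.den (add t zero)) 0 := by rw [h]
    _ = hT.den t + 1 := (hT.den_eq_of_rca (.add_succ t zero)).symm

theorem den_prec_zero (a b : Term .num) : hT.den (prec a b zero) = hT.den a :=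
  hT.den_eq_of_rca (.prec_zero a b)

theorem den_prec_succ (a b t : Term .num) :
    hT.den (prec a b (succ t)) = hT.map₂ b (hT.den (prec a b t)) (hT.den t) :=
  hT.den_eq_of_rca (.prec_succ a b t)

theorem den_pred (t : Term .num) : hT.den (pred t) = hT.den t - 1 := by
  have h : hT.den (monus t zero) = hT.den t := hT.den_prec_zero _ _
  calc hT.den (pred t) = hT.map₂ (pred (nv 0)) (hT.den t) 0 := rfl
    _ = hT.map₂ (pred (nv 0)) (hT.den (monus t zero)) 0 := by rw [h]
    _ = hT.den t - 1 := (hT.den_prec_succ t (pred (nv 0)) zero).symm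

theorem app_lam (s u : Term .num) : hT.app (lam s) (hT.den u) = hT.den (s.subst (Sub.single u)) :=
  (hT.den_app _ _).symm.trans (hT.den_eq_of_rca (.beta _ _))

/-! ### Definable functions and predicates -/

/-- Binary functions on the numbers of the term model that are defined by a term. -/
def Def (g : hT.Num → hT.Num → hT.Num) : Prop := ∃ s, hT.map₂ s = g

/-- Binary predicates on the numbers of the term model that are defined by a quantifier-free
formula. -/
def QF (P : hT.Num → hT.Num → Prop) : Prop :=
  ∃ φ : Formula, φ.QuantifierFree ∧ ∀ t u, T (φ.subst (Sub.double t u)) ↔ P (hT.den t) (hT.den u)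

variable {hT}

theorem Def.of_den {g : hT.Num → hT.Num → hT.Num} (s : Term .num)
    (h : ∀ t u, hT.den (s.subst (Sub.double t u)) = g (hT.den t) (hT.den u)) : hT.Def g :=
  ⟨s, funext₂ <| hT.den_surjective.forall₂.2 h⟩

theorem Def.fst : hT.Def fun x _ => x := .of_den (nv 0) fun _ _ => rfl

theorem Def.snd : hT.Def fun _ y => y := .of_den (nv 1) fun _ _ => rfl

theorem Def.const (z : hT.Num) : hT.Def fun _ _ => z := by
  obtain ⟨t, rfl⟩ := hT.den_surjective z
  exact .of_den ((t.lift .num).lift .num) fun _ _ => by rw [Term.lift_lift_subst_double]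

section

variable {g g' : hT.Num → hT.Num → hT.Num}

theorem Def.map₂ (s : Term .num) (h : hT.Def g) (h' : hT.Def g') :
    hT.Def fun x y => hT.map₂ s (g x y) (g' x y) := by
  obtain ⟨r, rfl⟩ := h
  obtain ⟨r', rfl⟩ := h'
  refine .of_den (s.subst (Sub.update₂ r r')) fun t u => ?_
  rw [Term.subst_subst, Sub.update₂_comp_double, map₂_den, map₂_den, map₂_den]

theorem Def.add (h : hT.Def g) (h' : hT.Def g') : hT.Def fun x y => g x y + g' x y :=
  .map₂ _ h h'

theorem Def.mul (h : hT.Def g) (h' : hT.Def g') : hT.Def fun x y => g x y * g' x y :=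
  .map₂ _ h h'

theorem Def.sub (h : hT.Def g) (h' : hT.Def g') : hT.Def fun x y => g x y - g' x y :=
  .map₂ _ h h'

theorem Def.twoPow (h : hT.Def g) : hT.Def fun x y => hT.twoPow (g x y) := .map₂ _ h h

theorem Def.tri (h : hT.Def g) : hT.Def fun x y => hT.tri (g x y) := .map₂ _ h h

theorem Def.triRoot (h : hT.Def g) : hT.Def fun x y => hT.triRoot (g x y) := .map₂ _ h h

theorem Def.app (f : Term .fn) (h : hT.Def g) : hT.Def fun x y => hT.app f (g x y) := .map₂ _ h h

theorem QF.eq (h : hT.Def g) (h' : hT.Def g') : hT.QF fun x y => g x y = g' x y := by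
  obtain ⟨s, rfl⟩ := h
  obtain ⟨s', rfl⟩ := h'
  exact ⟨.eq s s', trivial, fun t u => hT.eq_iff⟩

theorem QF.imp {P Q : hT.Num → hT.Num → Prop} (h : hT.QF P) (h' : hT.QF Q) :
    hT.QF fun x y => P x y → Q x y := by
  obtain ⟨φ, hφ, h⟩ := h
  obtain ⟨ψ, hψ, h'⟩ := h'
  exact ⟨.imp φ ψ, ⟨hφ, hψ⟩, fun t u => by rw [Formula.subst, hT.imp, h, h']⟩

theorem QF.not {P : hT.Num → hT.Num → Prop} (h : hT.QF P) : hT.QF fun x y => ¬P x y := by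
  obtain ⟨φ, hφ, h⟩ := h
  exact ⟨φ.neg, ⟨hφ, trivial⟩, fun t u => (hT.neg_iff (φ := φ.subst _)).trans (h t u).not⟩

theorem QF.or {P Q : hT.Num → hT.Num → Prop} (h : hT.QF P) (h' : hT.QF Q) :
    hT.QF fun x y => P x y ∨ Q x y := by
  simpa only [or_iff_not_imp_left] using h.not.imp h'

theorem QF.and {P Q : hT.Num → hT.Num → Prop} (h : hT.QF P) (h' : hT.QF Q) :
    hT.QF fun x y => P x y ∧ Q x y := by
  simpa only [Classical.not_imp, not_not] using (h.imp h'.not).not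

end

@[elab_as_elim]
theorem QF.induction {P : hT.Num → Prop} (hP : hT.QF fun x _ => P x) (zero : P 0)
    (succ : ∀ x, P x → P (x + 1)) (x : hT.Num) : P x := by
  obtain ⟨φ, hφ, h⟩ := hP
  obtain ⟨t, rfl⟩ := hT.den_surjective x
  let ψ := φ.subst ((Sub.single Term.zero).up .num)
  have hψ : ∀ t, T (ψ.inst t) ↔ P (hT.den t) := fun t => by
    rw [Formula.subst_up_inst, Sub.single_cons, h]
  have hstep : T (.all .num (ψ.imp (ψ.subst Sub.next))) := hT.all.2 fun t => hT.imp.2 fun ht => by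
    change T ((ψ.subst Sub.next).inst t)
    rw [Formula.subst_next_inst, hψ, den_succ]
    exact succ _ ((hψ t).1 ht)
  have hall : T (.all .num ψ) :=
    hT.imp.1 (hT.imp.1 (hT.ax (.ind ψ (hφ.subst _))) ((hψ .zero).2 zero)) hstep
  exact (hψ t).1 (hT.all.1 hall t)

theorem Def.exists_app_eq {g : hT.Num → hT.Num} (h : hT.Def fun x _ => g x) :
    ∃ f : Term .fn, ∀ x, hT.app f x = g x := by
  obtain ⟨s, hs⟩ := h
  refine ⟨lam (s.subst ((Sub.single zero).up .num)), hT.den_surjective.forall.2 fun t => ?_⟩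
  rw [app_lam, Term.subst_up_subst_single, Sub.single_cons, ← map₂_den, hs]

theorem QF.choice {P : hT.Num → hT.Num → Prop} (h : hT.QF P) (hP : ∀ x, ∃ y, P y x) :
    ∃ f : Term .fn, ∀ x, P (hT.app f x) x := by
  obtain ⟨φ, hφ, h⟩ := h
  have htotal : T (.all .num (.ex .num φ)) := hT.all.2 fun t => hT.ex_iff.2 <| by
    obtain ⟨u, hu⟩ := hT.den_surjective.exists.1 (hP (hT.den t))
    exact ⟨u, by rwa [Formula.subst_up_inst, Sub.single_cons, h]⟩
  obtain ⟨f, hf⟩ := hT.ex_iff.1 (hT.imp.1 (hT.ax (.choice φ hφ)) htotal)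
  refine ⟨f, hT.den_surjective.forall.2 fun t => ?_⟩
  have := hT.all.1 hf t
  rwa [Formula.subst_up_inst, Formula.subst_subst, Sub.choice_comp_cons_single, h, den_app] at this

end Henkin

namespace Henkin

variable {T : Formula → Prop} {hT : Henkin RCA₀ T}

/-! ### Arithmetic in the term model -/

section Semiring

protected theorem Num.add_zero (x : hT.Num) : x + 0 = x := by
  obtain ⟨t, rfl⟩ := hT.den_surjective x
  exact hT.den_eq_of_rca (.add_zero t)

protected theorem Num.add_succ (x y : hT.Num) : x + (y + 1) = x + y + 1 := by
  obtain ⟨t, rfl⟩ := hT.den_surjective x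
  obtain ⟨u, rfl⟩ := hT.den_surjective y
  rw [← den_succ, ← den_add, ← den_add, ← den_succ]
  exact hT.den_eq_of_rca (.add_succ t u)

protected theorem Num.mul_zero (x : hT.Num) : x * 0 = 0 := by
  obtain ⟨t, rfl⟩ := hT.den_surjective x
  exact hT.den_eq_of_rca (.mul_zero t)

protected theorem Num.mul_succ (x y : hT.Num) : x * (y + 1) = x * y + x := by
  obtain ⟨t, rfl⟩ := hT.den_surjective x
  obtain ⟨u, rfl⟩ := hT.den_surjective y
  rw [← den_succ]
  exact hT.den_eq_of_rca (.mul_succ t u)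

protected theorem Num.succ_ne_zero (x : hT.Num) : x + 1 ≠ 0 := by
  obtain ⟨t, rfl⟩ := hT.den_surjective x
  rw [← den_succ, ← den_zero, Ne, ← eq_iff]
  exact hT.neg_iff.1 (hT.ax (.succ_ne_zero t))

protected theorem Num.succ_injective {x y : hT.Num} (h : x + 1 = y + 1) : x = y := by
  obtain ⟨t, rfl⟩ := hT.den_surjective x
  obtain ⟨u, rfl⟩ := hT.den_surjective y
  rw [← den_succ, ← den_succ, ← eq_iff] at h
  exact hT.eq_iff.1 (hT.imp.1 (hT.ax (.succ_inj t u)) h)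

protected theorem Num.zero_add (x : hT.Num) : 0 + x = x := by
  induction x using QF.induction with
  | hP => exact .eq (.add (.const 0) .fst) .fst
  | zero => exact Num.add_zero 0
  | succ x ih => rw [Num.add_succ, ih]

protected theorem Num.succ_add (x y : hT.Num) : x + 1 + y = x + y + 1 := by
  induction y using QF.induction with
  | hP => exact .eq (.add (.const _) .fst) (.add (.add (.const _) .fst) (.const 1))
  | zero => rw [Num.add_zero, Num.add_zero]
  | succ y ih => rw [Num.add_succ, ih, Num.add_succ]

protected theorem Num.add_comm (x y : hT.Num) : x + y = y + x := by
  induction y using QF.induction with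
  | hP => exact .eq (.add (.const _) .fst) (.add .fst (.const _))
  | zero => rw [Num.add_zero, Num.zero_add]
  | succ y ih => rw [Num.add_succ, Num.succ_add, ih]

protected theorem Num.add_assoc (x y z : hT.Num) : x + y + z = x + (y + z) := by
  induction z using QF.induction with
  | hP => exact .eq (.add (.const _) .fst) (.add (.const _) (.add (.const _) .fst))
  | zero => rw [Num.add_zero, Num.add_zero]
  | succ z ih => rw [Num.add_succ, Num.add_succ, Num.add_succ, ih]

instance : AddCommMonoid hT.Num where
  add_assoc := Num.add_assoc
  zero_add := Num.zero_add
  add_zero := Num.add_zero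
  add_comm := Num.add_comm
  nsmul := nsmulRec

protected theorem Num.zero_mul (x : hT.Num) : 0 * x = 0 := by
  induction x using QF.induction with
  | hP => exact .eq (.mul (.const _) .fst) (.const 0)
  | zero => exact Num.mul_zero 0
  | succ x ih => rw [Num.mul_succ, ih, add_zero]

protected theorem Num.succ_mul (x y : hT.Num) : (x + 1) * y = x * y + y := by
  induction y using QF.induction with
  | hP => exact .eq (.mul (.const _) .fst) (.add (.mul (.const _) .fst) .fst)
  | zero => rw [Num.mul_zero, Num.mul_zero, add_zero]
  | succ y ih => rw [Num.mul_succ, Num.mul_succ, ih]; abel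

protected theorem Num.mul_comm (x y : hT.Num) : x * y = y * x := by
  induction y using QF.induction with
  | hP => exact .eq (.mul (.const _) .fst) (.mul .fst (.const _))
  | zero => rw [Num.mul_zero, Num.zero_mul]
  | succ y ih => rw [Num.mul_succ, Num.succ_mul, ih]

protected theorem Num.mul_add (x y z : hT.Num) : x * (y + z) = x * y + x * z := by
  induction z using QF.induction with
  | hP =>
    exact .eq (.mul (.const _) (.add (.const _) .fst)) (.add (.const _) (.mul (.const _) .fst))
  | zero => rw [Num.mul_zero, add_zero, add_zero]
  | succ z ih => rw [← add_assoc, Num.mul_succ, Num.mul_succ, ih, add_assoc]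

protected theorem Num.mul_assoc (x y z : hT.Num) : x * y * z = x * (y * z) := by
  induction z using QF.induction with
  | hP => exact .eq (.mul (.const _) .fst) (.mul (.const _) (.mul (.const _) .fst))
  | zero => rw [Num.mul_zero, Num.mul_zero, Num.mul_zero]
  | succ z ih => rw [Num.mul_succ, Num.mul_succ, Num.mul_add, ih]

protected theorem Num.mul_one (x : hT.Num) : x * 1 = x := by
  rw [← zero_add (1 : hT.Num), Num.mul_succ, Num.mul_zero, zero_add]

instance : CommSemiring hT.Num where
  left_distrib := Num.mul_add
  right_distrib x y z := by rw [Num.mul_comm, Num.mul_add, Num.mul_comm z, Num.mul_comm z]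
  zero_mul := Num.zero_mul
  mul_zero := Num.mul_zero
  mul_assoc := Num.mul_assoc
  one_mul x := by rw [Num.mul_comm, Num.mul_one]
  mul_one := Num.mul_one
  mul_comm := Num.mul_comm

end Semiring

section Order

protected theorem Num.zero_sub_one : (0 : hT.Num) - 1 = 0 := by
  rw [← den_zero, ← den_pred]
  exact hT.den_prec_zero _ _

protected theorem Num.succ_sub_one (x : hT.Num) : x + 1 - 1 = x := by
  obtain ⟨t, rfl⟩ := hT.den_surjective x
  rw [← den_succ, ← den_pred]
  exact hT.den_prec_succ _ _ t

protected theorem Num.sub_zero (x : hT.Num) : x - 0 = x := by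
  obtain ⟨t, rfl⟩ := hT.den_surjective x
  exact hT.den_prec_zero _ _

protected theorem Num.sub_succ (x y : hT.Num) : x - (y + 1) = x - y - 1 := by
  obtain ⟨t, rfl⟩ := hT.den_surjective x
  obtain ⟨u, rfl⟩ := hT.den_surjective y
  rw [← den_succ, ← den_monus, ← den_monus, ← den_pred]
  exact hT.den_prec_succ _ _ u

protected theorem Num.succ_sub_succ (x y : hT.Num) : x + 1 - (y + 1) = x - y := by
  induction y using QF.induction with
  | hP => exact .eq (.sub (.const _) (.add .fst (.const 1))) (.sub (.const _) .fst)
  | zero => rw [Num.sub_succ, Num.sub_zero, Num.sub_zero, Num.succ_sub_one]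
  | succ y ih => rw [Num.sub_succ, ih, Num.sub_succ]

protected theorem Num.add_sub_cancel_left (x y : hT.Num) : x + y - x = y := by
  induction x using QF.induction with
  | hP => exact .eq (.sub (.add .fst (.const _)) .fst) (.const _)
  | zero => rw [Num.sub_zero, zero_add]
  | succ x ih => rw [add_right_comm, Num.succ_sub_succ, ih]

protected theorem Num.sub_add_self (x y : hT.Num) : x - (x + y) = 0 := by
  induction y using QF.induction with
  | hP => exact .eq (.sub (.const _) (.add (.const _) .fst)) (.const 0)
  | zero => simpa only [add_zero] using Num.add_sub_cancel_left x 0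
  | succ y ih => rw [← add_assoc, Num.sub_succ, ih, Num.zero_sub_one]

theorem Num.eq_zero_or_eq_succ (x : hT.Num) : x = 0 ∨ x = x - 1 + 1 := by
  induction x using QF.induction with
  | hP => exact .or (.eq .fst (.const 0)) (.eq .fst (.add (.sub .fst (.const 1)) (.const 1)))
  | zero => exact .inl rfl
  | succ x => exact .inr (by rw [Num.succ_sub_one])

theorem Num.add_sub_eq_or_add_sub_eq (x y : hT.Num) : x + (y - x) = y ∨ y + (x - y) = x := by
  induction y using QF.induction with
  | hP =>
    exact .or (.eq (.add (.const _) (.sub .fst (.const _))) .fst)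
      (.eq (.add .fst (.sub (.const _) .fst)) (.const _))
  | zero => exact .inr (by rw [Num.sub_zero, zero_add])
  | succ y ih =>
    rcases ih with h | h
    · rw [← h, add_assoc, Num.add_sub_cancel_left]
      exact .inl rfl
    · rcases (x - y).eq_zero_or_eq_succ with h0 | h0
      · rw [h0, add_zero] at h
        rw [h, Num.add_sub_cancel_left]
        exact .inl rfl
      · rw [Num.sub_succ, add_assoc, add_comm 1, ← h0]
        exact .inr h

instance : IsCancelAdd hT.Num :=
  have : IsRightCancelAdd hT.Num := ⟨fun z x y h => by
    induction z using QF.induction with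
    | hP =>
      exact .imp (.eq (.add (.const _) .fst) (.add (.const _) .fst)) (.eq (.const _) (.const _))
    | zero => simpa only [add_zero] using h
    | succ z ih =>
      simp only [← add_assoc] at h
      exact ih (Num.succ_injective h)⟩
  AddCommMagma.IsRightCancelAdd.toIsCancelAdd _

protected theorem Num.eq_zero_of_add_eq_zero {x y : hT.Num} (h : x + y = 0) : y = 0 := by
  refine y.eq_zero_or_eq_succ.resolve_right fun hy => ?_
  rw [hy, ← add_assoc] at h
  exact Num.succ_ne_zero _ h

noncomputable instance : LinearOrder hT.Num where
  le x y := ∃ z, y = x + z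
  le_refl x := ⟨0, (add_zero x).symm⟩
  le_trans x y z := by
    rintro ⟨c, rfl⟩ ⟨d, rfl⟩
    exact ⟨c + d, add_assoc x c d⟩
  le_antisymm x y := by
    rintro ⟨c, rfl⟩ ⟨d, h⟩
    rw [add_assoc, left_eq_add, add_comm] at h
    rw [Num.eq_zero_of_add_eq_zero h, add_zero]
  le_total x y :=
    (Num.add_sub_eq_or_add_sub_eq x y).imp (fun h => ⟨_, h.symm⟩) fun h => ⟨_, h.symm⟩
  toDecidableLE := Classical.decRel _

instance : CanonicallyOrderedAdd hT.Num where
  exists_add_of_le := id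
  le_add_self x y := ⟨y, add_comm y x⟩
  le_self_add _ y := ⟨y, rfl⟩

instance : IsOrderedCancelAddMonoid hT.Num where
  add_le_add_left _ _ := by
    rintro ⟨c, rfl⟩ z
    exact ⟨c, add_right_comm _ c z⟩
  le_of_add_le_add_left _ _ _ := by
    rintro ⟨c, h⟩
    rw [add_assoc] at h
    exact ⟨c, add_left_cancel h⟩

instance : OrderedSub hT.Num where
  tsub_le_iff_right x y z := by
    obtain ⟨c, rfl⟩ | ⟨c, rfl⟩ := le_total x y
    · rw [Num.sub_add_self, add_left_comm]
      exact ⟨fun _ => le_self_add, fun _ => zero_le⟩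
    · rw [Num.add_sub_cancel_left, add_comm, add_le_add_iff_right]

instance : Nontrivial hT.Num := ⟨0, 1, fun h => Num.succ_ne_zero 0 (by rw [zero_add, h])⟩

instance : NoZeroDivisors hT.Num where
  eq_zero_or_eq_zero_of_mul_eq_zero {x y} h := by
    rw [or_iff_not_imp_right]
    intro hy
    rw [y.eq_zero_or_eq_succ.resolve_left hy, mul_add, mul_one] at h
    exact Num.eq_zero_of_add_eq_zero h

noncomputable instance : SuccAddOrder hT.Num where
  toSuccOrder := .ofSuccLeIff (· + 1) fun {x y} => by
    refine ⟨(lt_add_one x).trans_le, fun h => ?_⟩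
    obtain ⟨c, hc, rfl⟩ := lt_iff_exists_pos_add.1 h
    rw [c.eq_zero_or_eq_succ.resolve_left hc.ne', add_left_comm]
    exact le_add_self
  succ_eq_add_one _ := rfl

instance : NoMaxOrder hT.Num := ⟨fun x => ⟨x + 1, lt_add_one x⟩⟩

theorem QF.le {g g' : hT.Num → hT.Num → hT.Num} (h : hT.Def g) (h' : hT.Def g') :
    hT.QF fun x y => g x y ≤ g' x y := by
  simpa only [tsub_eq_zero_iff_le] using QF.eq (h.sub h') (.const 0)

theorem QF.lt {g g' : hT.Num → hT.Num → hT.Num} (h : hT.Def g) (h' : hT.Def g') :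
    hT.QF fun x y => g x y < g' x y := by
  simpa only [not_le] using (QF.le h' h).not

end Order

section Recursion

theorem twoPow_zero : hT.twoPow 0 = 1 := hT.den_prec_zero _ _

theorem twoPow_succ (x : hT.Num) : hT.twoPow (x + 1) = hT.twoPow x + hT.twoPow x := by
  obtain ⟨t, rfl⟩ := hT.den_surjective x
  rw [← den_succ]
  exact hT.den_prec_succ _ _ t

theorem tri_zero : hT.tri 0 = 0 := hT.den_prec_zero _ _

theorem tri_succ (x : hT.Num) : hT.tri (x + 1) = hT.tri x + (x + 1) := by
  obtain ⟨t, rfl⟩ := hT.den_surjective x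
  rw [← den_succ]
  exact hT.den_prec_succ _ _ t

theorem triRoot_zero : hT.triRoot 0 = 0 := hT.den_prec_zero _ _

theorem triRoot_succ (x : hT.Num) :
    hT.triRoot (x + 1) = hT.triRoot x + (1 - (hT.tri (hT.triRoot x + 1) - (x + 1))) := by
  obtain ⟨t, rfl⟩ := hT.den_surjective x
  rw [← den_succ, ← hT.den_triRoot t, ← den_succ]
  exact hT.den_prec_succ _ _ t

end Recursion

end Henkin

/-! ### The ordered field of fractions of an ordered semiring -/

section Differences

variable (N : Type*) [CommSemiring N] [IsCancelAdd N]

/-- Equality of formal differences `a - b`, which are written as `a + b ε` with `ε² = 1`. -/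
def diffCon : RingCon (QuadraticAlgebra N 1 0) where
  r x y := x.re + y.im = y.re + x.im
  iseqv := ⟨fun _ => rfl, fun h => h.symm, fun {x y z} h h' => by
    refine add_right_cancel (b := y.re + y.im) ?_
    calc x.re + z.im + (y.re + y.im) = (x.re + y.im) + (y.re + z.im) := by ring
      _ = z.re + x.im + (y.re + y.im) := by rw [h, h']; ring⟩
  add' {w x y z} h h' := by
    simp only [QuadraticAlgebra.re_add, QuadraticAlgebra.im_add]
    calc w.re + y.re + (x.im + z.im) = (w.re + x.im) + (y.re + z.im) := by ring
      _ = x.re + z.re + (w.im + y.im) := by rw [h, h']; ring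
  mul' {w x y z} h h' := by
    simp only [QuadraticAlgebra.re_mul, QuadraticAlgebra.im_mul]
    refine add_right_cancel (b := x.re * y.im + x.im * y.re) ?_
    calc _ = y.re * (w.re + x.im) + y.im * (x.re + w.im) + x.re * z.im + x.im * z.re := by ring
      _ = y.re * (x.re + w.im) + y.im * (w.re + x.im) + x.re * z.im + x.im * z.re := by rw [h]
      _ = x.re * (y.re + z.im) + x.im * (z.re + y.im) + w.re * y.im + w.im * y.re := by ring
      _ = x.re * (z.re + y.im) + x.im * (y.re + z.im) + w.re * y.im + w.im * y.re := by rw [h']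
      _ = _ := by ring

/-- The ring of differences of a cancellative commutative semiring. -/
def Diff : Type _ := (diffCon N).Quotient

namespace Diff

instance : CommSemiring (Diff N) := inferInstanceAs (CommSemiring (diffCon N).Quotient)

variable {N}

/-- The difference `a - b`. -/
def mk (a b : N) : Diff N := (diffCon N).mk' ⟨a, b⟩

theorem mk_eq_mk {a b c d : N} : mk a b = mk c d ↔ a + d = c + b := (diffCon N).eq

theorem exists_eq_mk (x : Diff N) : ∃ a b, x = mk a b := by
  obtain ⟨⟨a, b⟩, rfl⟩ := (diffCon N).mk'_surjective x
  exact ⟨a, b, rfl⟩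

theorem mk_add_mk (a b c d : N) : mk a b + mk c d = mk (a + c) (b + d) := by
  rw [mk, mk, mk]
  exact ((diffCon N).mk'.map_add _ _).symm

theorem mk_mul_mk (a b c d : N) : mk a b * mk c d = mk (a * c + b * d) (a * d + b * c) := by
  rw [mk, mk, mk]
  refine ((diffCon N).mk'.map_mul _ _).symm.trans (congrArg _ ?_)
  ext <;> simp

theorem mk_self (a : N) : mk a a = 0 := mk_eq_mk.2 (by rw [add_zero, zero_add])

theorem exists_neg (x : Diff N) : ∃ y, y + x = 0 := by
  obtain ⟨a, b, rfl⟩ := x.exists_eq_mk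
  exact ⟨mk b a, by rw [mk_add_mk, add_comm, mk_self]⟩

noncomputable instance : Neg (Diff N) := ⟨fun x => x.exists_neg.choose⟩

noncomputable instance : CommRing (Diff N) where
  zsmul := zsmulRec
  neg_add_cancel x := x.exists_neg.choose_spec

/-- The embedding of a semiring into its ring of differences. -/
def of : N →+* Diff N where
  toFun a := mk a 0
  map_zero' := mk_self 0
  map_one' := (diffCon N).mk'.map_one
  map_add' a b := by rw [mk_add_mk, add_zero]
  map_mul' a b := by rw [mk_mul_mk]; simp

theorem of_injective : Function.Injective (of (N := N)) := fun a b h => by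
  simpa only [add_zero] using mk_eq_mk.1 h

theorem mk_eq_sub (a b : N) : mk a b = of a - of b := by
  rw [eq_sub_iff_add_eq]
  exact (mk_add_mk a b b 0).trans (mk_eq_mk.2 (by ring))

end Diff

end Differences

namespace Diff

variable {N : Type*} [CommSemiring N] [LinearOrder N] [IsOrderedCancelAddMonoid N]
  [CanonicallyOrderedAdd N]

theorem exists_eq_of_or_eq_neg_of (x : Diff N) : ∃ a, x = of a ∨ x = -of a := by
  obtain ⟨a, b, rfl⟩ := x.exists_eq_mk
  obtain ⟨c, rfl⟩ | ⟨c, rfl⟩ := (le_total a b).imp exists_add_of_le exists_add_of_le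
  · exact ⟨c, .inr (by rw [mk_eq_sub, map_add, sub_add_cancel_left])⟩
  · exact ⟨c, .inl (by rw [mk_eq_sub, map_add, add_sub_cancel_left])⟩

instance [Nontrivial N] : Nontrivial (Diff N) := of_injective.nontrivial

instance [NoZeroDivisors N] : NoZeroDivisors (Diff N) where
  eq_zero_or_eq_zero_of_mul_eq_zero {x y} h := by
    obtain ⟨a, rfl | rfl⟩ := x.exists_eq_of_or_eq_neg_of <;>
      obtain ⟨b, rfl | rfl⟩ := y.exists_eq_of_or_eq_neg_of <;>
      simpa only [neg_mul, mul_neg, neg_neg, neg_eq_zero, ← map_mul,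
        map_eq_zero_iff of of_injective, mul_eq_zero] using h

instance [Nontrivial N] [NoZeroDivisors N] : IsDomain (Diff N) := NoZeroDivisors.to_isDomain _

end Diff

section Fractions

variable (N : Type*) [CommSemiring N] [LinearOrder N] [IsOrderedCancelAddMonoid N]
  [CanonicallyOrderedAdd N] [Nontrivial N] [NoZeroDivisors N]

/-- The field of fractions of an ordered semiring, ordered by `0 ≤ a / b` for all `a` and `b` in the
semiring. -/
def Frac : Type _ := FractionRing (Diff N)

namespace Frac

noncomputable instance : Field (Frac N) := inferInstanceAs (Field (FractionRing (Diff N)))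

noncomputable instance : Algebra (Diff N) (Frac N) :=
  inferInstanceAs (Algebra (Diff N) (FractionRing (Diff N)))

instance : IsFractionRing (Diff N) (Frac N) :=
  inferInstanceAs (IsFractionRing (Diff N) (FractionRing (Diff N)))

/-- The embedding of an ordered semiring into its field of fractions. -/
noncomputable def of : N →+* Frac N := (algebraMap (Diff N) (Frac N)).comp Diff.of

variable {N}

theorem of_injective : Function.Injective (of N) :=
  (IsFractionRing.injective (Diff N) (Frac N)).comp Diff.of_injective

theorem of_ne_zero {a : N} (h : a ≠ 0) : of N a ≠ 0 := (map_ne_zero_iff _ of_injective).2 h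

theorem exists_eq_div_or_neg_eq_div (x : Frac N) :
    ∃ a b, b ≠ 0 ∧ (x = of N a / of N b ∨ -x = of N a / of N b) := by
  obtain ⟨y, z, hz, rfl⟩ := IsFractionRing.div_surjective (A := Diff N) x
  have hz := nonZeroDivisors.ne_zero hz
  obtain ⟨a, rfl | rfl⟩ := y.exists_eq_of_or_eq_neg_of <;>
    obtain ⟨b, rfl | rfl⟩ := z.exists_eq_of_or_eq_neg_of <;>
    exact ⟨a, b, fun hb => hz (by simp [hb]), by simp [of, neg_div, div_neg]⟩

variable (N) in
/-- The nonnegative fractions. -/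
noncomputable def nonnegCone : RingCone (Frac N) where
  carrier := {x | ∃ a b, b ≠ 0 ∧ x = of N a / of N b}
  zero_mem' := ⟨0, 1, one_ne_zero, by simp⟩
  one_mem' := ⟨1, 1, one_ne_zero, by simp⟩
  add_mem' := by
    rintro _ _ ⟨a, b, hb, rfl⟩ ⟨c, d, hd, rfl⟩
    refine ⟨a * d + b * c, b * d, mul_ne_zero hb hd, ?_⟩
    rw [div_add_div _ _ (of_ne_zero hb) (of_ne_zero hd), map_add, map_mul, map_mul, map_mul]
  mul_mem' := by
    rintro _ _ ⟨a, b, hb, rfl⟩ ⟨c, d, hd, rfl⟩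
    exact ⟨a * c, b * d, mul_ne_zero hb hd, by simp only [map_mul, div_mul_div_comm]⟩
  eq_zero_of_mem_of_neg_mem' := by
    rintro _ ⟨a, b, hb, rfl⟩ ⟨c, d, hd, h⟩
    rw [← neg_div, div_eq_div_iff (of_ne_zero hb) (of_ne_zero hd)] at h
    have hsum : a * d + c * b = 0 := of_injective <| by
      simp only [map_add, map_mul, map_zero]
      linear_combination -h
    have ha : a = 0 := (mul_eq_zero.1 (add_eq_zero.1 hsum).1).resolve_right hd
    rw [ha, map_zero, zero_div]

instance : HasMemOrNegMem (nonnegCone N) where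
  mem_or_neg_mem x := by
    obtain ⟨a, b, hb, h⟩ := exists_eq_div_or_neg_eq_div x
    exact h.imp (fun h => ⟨a, b, hb, h⟩) fun h => ⟨a, b, hb, h⟩

open scoped Classical in
noncomputable instance : LinearOrder (Frac N) := LinearOrder.mkOfAddGroupCone (nonnegCone N)

instance : IsOrderedRing (Frac N) := .mkOfCone (nonnegCone N)

instance : IsStrictOrderedRing (Frac N) := IsOrderedRing.toIsStrictOrderedRing _

theorem nonneg_iff {x : Frac N} : 0 ≤ x ↔ ∃ a b, b ≠ 0 ∧ x = of N a / of N b := by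
  change x - 0 ∈ nonnegCone N ↔ _
  rw [sub_zero]
  rfl

theorem of_nonneg (a : N) : 0 ≤ of N a := nonneg_iff.2 ⟨a, 1, one_ne_zero, by simp⟩

theorem of_strictMono : StrictMono (of N) := by
  refine Monotone.strictMono_of_injective (fun a b h => ?_) of_injective
  obtain ⟨c, rfl⟩ := exists_add_of_le h
  rw [map_add]
  exact le_add_of_nonneg_right (of_nonneg c)

end Frac

end Fractions

/-! ### The field of limits of converging sequences -/

/-- A ring of sequences in an ordered field that suffices to construct real numbers: it is closed
under shifts, inverses and approximate square roots. The index set `N` may have nonstandard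
elements, and `e n` plays the role of `2⁻ⁿ`. -/
structure SeqSpace (N K : Type*) [AddCommMonoid N] [Field K] [LinearOrder K]
    [IsStrictOrderedRing K] where
  e : N → K
  e_add (m n : N) : e (m + n) = e m * e n
  e_pos (n : N) : 0 < e n
  e_le_one (n : N) : e n ≤ 1
  exists_e_lt (x : K) : 0 < x → ∃ n, e n < x
  seqs : Subring (N → K)
  shift_mem {s : N → K} (m : N) : s ∈ seqs → (fun k => s (m + k)) ∈ seqs
  inv_mem {s : N → K} : s ∈ seqs → (∀ k, s k ≠ 0) → s⁻¹ ∈ seqs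
  exists_approx_sqrt {s : N → K} : s ∈ seqs → (∀ k, 0 ≤ s k) →
    ∃ t ∈ seqs, ∀ k, 0 ≤ t k ∧ |t k * t k - s (k + k)| ≤ e k * e k

namespace SeqSpace

variable {N K : Type*} [AddCommMonoid N] [Field K] [LinearOrder K] [IsStrictOrderedRing K]
  (𝒮 : SeqSpace N K)

theorem e_add_le (m k : N) : 𝒮.e (m + k) ≤ 𝒮.e k := by
  rw [𝒮.e_add]
  exact mul_le_of_le_one_left (𝒮.e_pos k).le (𝒮.e_le_one m)

theorem exists_mul_e_lt (C : K) {δ : K} (hδ : 0 < δ) : ∃ n, C * 𝒮.e n < δ := by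
  have hC : 0 < |C| + 1 := by positivity
  obtain ⟨n, hn⟩ := 𝒮.exists_e_lt (δ / (|C| + 1)) (by positivity)
  refine ⟨n, lt_of_le_of_lt ?_ ((lt_div_iff₀' hC).1 hn)⟩
  exact mul_le_mul_of_nonneg_right ((le_abs_self C).trans (by linarith)) (𝒮.e_pos n).le

/-- Convergence with the modulus `C * 2⁻ᵏ`. Real numbers are the sequences with `C = 1`. -/
def ConvergesWith (C : K) (s : N → K) : Prop := ∀ k i, |s k - s (k + i)| ≤ C * 𝒮.e k

namespace ConvergesWith

variable {𝒮} {C D : K} {s t : N → K}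

theorem mono (h : 𝒮.ConvergesWith C s) (hCD : C ≤ D) : 𝒮.ConvergesWith D s := fun k i =>
  (h k i).trans (mul_le_mul_of_nonneg_right hCD (𝒮.e_pos k).le)

theorem shift (h : 𝒮.ConvergesWith C s) (n : N) :
    𝒮.ConvergesWith (C * 𝒮.e n) fun k => s (n + k) := fun k i => by
  beta_reduce
  rw [← add_assoc, mul_assoc, ← 𝒮.e_add]
  exact h (n + k) i

theorem const (x : K) : 𝒮.ConvergesWith 0 fun _ => x := fun k i => by simp

theorem neg (h : 𝒮.ConvergesWith C s) : 𝒮.ConvergesWith C (-s) := fun k i => by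
  rw [Pi.neg_apply, Pi.neg_apply, neg_sub_neg, abs_sub_comm]
  exact h k i

theorem add (hs : 𝒮.ConvergesWith C s) (ht : 𝒮.ConvergesWith D t) :
    𝒮.ConvergesWith (C + D) (s + t) := fun k i => by
  rw [Pi.add_apply, Pi.add_apply, add_sub_add_comm, add_mul]
  exact (abs_add_le _ _).trans (add_le_add (hs k i) (ht k i))

theorem abs_le (h : 𝒮.ConvergesWith C s) (k : N) : |s k| ≤ |s 0| + C * 𝒮.e 0 := by
  have h₀ := h 0 k
  rw [zero_add, abs_sub_comm] at h₀
  linarith [abs_sub_abs_le_abs_sub (s k) (s 0)]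

theorem mul {A B : K} (hs : 𝒮.ConvergesWith C s) (ht : 𝒮.ConvergesWith D t)
    (hA : ∀ k, |s k| ≤ A) (hB : ∀ k, |t k| ≤ B) :
    𝒮.ConvergesWith (C * B + A * D) (s * t) := fun k i => by
  have hC := (abs_nonneg _).trans (hs k i)
  have hA₀ := (abs_nonneg _).trans (hA k)
  calc |s k * t k - s (k + i) * t (k + i)|
      = |(s k - s (k + i)) * t k + s (k + i) * (t k - t (k + i))| := by ring_nf
    _ ≤ |s k - s (k + i)| * |t k| + |s (k + i)| * |t k - t (k + i)| := by
      rw [← abs_mul, ← abs_mul]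
      exact abs_add_le _ _
    _ ≤ C * 𝒮.e k * B + A * (D * 𝒮.e k) := by
      gcongr
      exacts [hs k i, hB k, hA _, ht k i]
    _ = (C * B + A * D) * 𝒮.e k := by ring

theorem mul_shift {m : N} (hs : 𝒮.ConvergesWith 1 s) (ht : 𝒮.ConvergesWith 1 t)
    (hm : 𝒮.e m * (|s 0| + |t 0| + 2) ≤ 1) :
    𝒮.ConvergesWith 1 fun k => s (m + k) * t (m + k) := by
  have h_bound {s : N → K} (hs : 𝒮.ConvergesWith 1 s) (k : N) : |s (m + k)| ≤ |s 0| + 1 :=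
    (hs.abs_le _).trans (by linarith [𝒮.e_le_one 0])
  exact ((hs.shift m).mul (ht.shift m) (h_bound hs) (h_bound ht)).mono (by linarith)

theorem inv {δ : K} (hδ : 0 < δ) (h : 𝒮.ConvergesWith C s) (hs : ∀ k, δ ≤ |s k|) :
    𝒮.ConvergesWith (C / (δ * δ)) s⁻¹ := fun k i => by
  have h₀ (k : N) : s k ≠ 0 := abs_pos.1 (hδ.trans_le (hs k))
  have hC := (abs_nonneg _).trans (h k i)
  rw [Pi.inv_apply, Pi.inv_apply, inv_sub_inv (h₀ _) (h₀ _), abs_div, abs_mul, abs_sub_comm,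
    div_mul_eq_mul_div]
  gcongr
  exacts [h k i, hs k, hs _]

theorem approx_sqrt (hs : 𝒮.ConvergesWith 1 s) (ht : ∀ k, 0 ≤ t k)
    (h : ∀ k, |t k * t k - s (k + k)| ≤ 𝒮.e k * 𝒮.e k) : 𝒮.ConvergesWith 2 t := fun k i => by
  have he := 𝒮.e_pos k
  have h_shift : |s (k + k) - s (k + i + (k + i))| ≤ 𝒮.e k * 𝒮.e k := by
    simpa only [one_mul, 𝒮.e_add, add_add_add_comm] using hs (k + k) (i + i)
  have h_next : |t (k + i) * t (k + i) - s (k + i + (k + i))| ≤ 𝒮.e k * 𝒮.e k := by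
    have hle : 𝒮.e (k + i) ≤ 𝒮.e k := by
      rw [add_comm]
      exact 𝒮.e_add_le i k
    exact (h (k + i)).trans (mul_self_le_mul_self (𝒮.e_pos _).le hle)
  have h_squares : |t k * t k - t (k + i) * t (k + i)| ≤ 3 * (𝒮.e k * 𝒮.e k) := by
    have h_k := h k
    rw [_root_.abs_le] at *
    constructor <;> linarith
  have h_sq : |t k - t (k + i)| * |t k - t (k + i)| ≤ |t k * t k - t (k + i) * t (k + i)| := by
    rw [mul_self_sub_mul_self, abs_mul, mul_comm]
    refine mul_le_mul_of_nonneg_right ?_ (abs_nonneg _)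
    rw [abs_of_nonneg (add_nonneg (ht k) (ht _)), _root_.abs_le]
    constructor <;> linarith [ht k, ht (k + i)]
  refine abs_le_of_sq_le_sq' ?_ (by positivity) |> _root_.abs_le.2
  rw [← sq_abs]
  nlinarith [mul_pos he he]

end ConvergesWith

/-- The ring of converging sequences. -/
def convergent : Subring (N → K) where
  carrier := {s | s ∈ 𝒮.seqs ∧ ∃ C, 𝒮.ConvergesWith C s}
  zero_mem' := ⟨𝒮.seqs.zero_mem, 0, .const 0⟩
  one_mem' := ⟨𝒮.seqs.one_mem, 0, .const 1⟩
  neg_mem' := fun ⟨hs, _, h⟩ => ⟨𝒮.seqs.neg_mem hs, _, h.neg⟩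
  add_mem' := fun ⟨hs, _, h⟩ ⟨ht, _, h'⟩ => ⟨𝒮.seqs.add_mem hs ht, _, h.add h'⟩
  mul_mem' := fun ⟨hs, _, h⟩ ⟨ht, _, h'⟩ => ⟨𝒮.seqs.mul_mem hs ht, _, h.mul h' h.abs_le h'.abs_le⟩

/-- The ideal of null sequences. -/
def null : Ideal 𝒮.convergent where
  carrier := {s | ∃ C, ∀ k, |s.1 k| ≤ C * 𝒮.e k}
  zero_mem' := ⟨0, fun k => by simp⟩
  add_mem' := fun ⟨C, h⟩ ⟨D, h'⟩ => ⟨C + D, fun k => by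
    rw [add_mul]
    exact (abs_add_le _ _).trans (add_le_add (h k) (h' k))⟩
  smul_mem' := fun ⟨s, _, C, hs⟩ t ⟨D, ht⟩ => ⟨(|s 0| + C * 𝒮.e 0) * D, fun k => by
    have hB := (abs_nonneg _).trans (hs.abs_le k)
    change |s k * t.1 k| ≤ _
    rw [abs_mul, mul_assoc]
    exact mul_le_mul (hs.abs_le k) (ht k) (abs_nonneg _) hB⟩

theorem notMem_null {s : 𝒮.convergent} {δ : K} (hδ : 0 < δ) (hs : ∀ k, δ ≤ |s.1 k|) :
    s ∉ 𝒮.null := by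
  rintro ⟨C, h⟩
  obtain ⟨n, hn⟩ := 𝒮.exists_mul_e_lt C hδ
  exact absurd ((hs n).trans (h n)) hn.not_ge

/-- The field of limits: converging sequences modulo null sequences. -/
def Limit : Type _ := 𝒮.convergent ⧸ 𝒮.null

instance : CommRing 𝒮.Limit := inferInstanceAs (CommRing (𝒮.convergent ⧸ 𝒮.null))

/-- The limit of a converging sequence. -/
def lim : 𝒮.convergent →+* 𝒮.Limit := Ideal.Quotient.mk 𝒮.null

variable {𝒮}

theorem lim_surjective : Function.Surjective 𝒮.lim := Ideal.Quotient.mk_surjective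

theorem lim_eq_zero {s : 𝒮.convergent} : 𝒮.lim s = 0 ↔ s ∈ 𝒮.null := Ideal.Quotient.eq_zero_iff_mem

theorem lim_eq_lim {s t : 𝒮.convergent} : 𝒮.lim s = 𝒮.lim t ↔ s - t ∈ 𝒮.null := Ideal.Quotient.eq

/-- The sequence `k ↦ s (n + k)`. -/
def shift (n : N) (s : 𝒮.convergent) : 𝒮.convergent :=
  ⟨fun k => s.1 (n + k), 𝒮.shift_mem n s.2.1, _, s.2.2.choose_spec.shift n⟩

theorem lim_shift (n : N) (s : 𝒮.convergent) : 𝒮.lim (shift n s) = 𝒮.lim s := by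
  obtain ⟨C, h⟩ := s.2.2
  refine (lim_eq_lim.2 ⟨C, fun k => ?_⟩).symm
  change |s.1 k - s.1 (n + k)| ≤ _
  rw [add_comm]
  exact h k n

/-- Skipping `p` terms divides the modulus by `2ᵖ`. -/
theorem exists_lim_eq (x : 𝒮.Limit) : ∃ s : 𝒮.convergent, 𝒮.ConvergesWith 1 s.1 ∧ 𝒮.lim s = x := by
  obtain ⟨s, rfl⟩ := lim_surjective x
  obtain ⟨C, h⟩ := s.2.2
  obtain ⟨p, hp⟩ := 𝒮.exists_mul_e_lt C one_pos
  exact ⟨shift p s, (h.shift p).mono hp.le, lim_shift p s⟩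

theorem lim_eq_lim_iff {s t : 𝒮.convergent} (hs : 𝒮.ConvergesWith 1 s.1)
    (ht : 𝒮.ConvergesWith 1 t.1) :
    𝒮.lim s = 𝒮.lim t ↔ ∀ k, |s.1 k - t.1 k| ≤ 2 * 𝒮.e k := by
  rw [lim_eq_lim]
  refine ⟨fun ⟨C, h⟩ k => le_of_forall_pos_le_add fun ε hε => ?_, fun h => ⟨2, h⟩⟩
  obtain ⟨j, hj⟩ := 𝒮.exists_mul_e_lt C hε
  have h_near : |s.1 (j + k) - t.1 (j + k)| ≤ C * 𝒮.e j := by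
    have hC : 0 ≤ C := nonneg_of_mul_nonneg_left ((abs_nonneg _).trans (h 0)) (𝒮.e_pos 0)
    refine (h (j + k)).trans (mul_le_mul_of_nonneg_left ?_ hC)
    rw [add_comm]
    exact 𝒮.e_add_le k j
  have h_s := hs k j
  have h_t := ht k j
  rw [add_comm k] at h_s h_t
  rw [abs_le] at *
  constructor <;> linarith

theorem exists_lim_eq_of_ne_zero {x : 𝒮.Limit} (hx : x ≠ 0) :
    ∃ s : 𝒮.convergent, 𝒮.ConvergesWith 1 s.1 ∧ 𝒮.lim s = x ∧
      ∃ δ > 0, (∀ k, δ ≤ s.1 k) ∨ ∀ k, δ ≤ -s.1 k := by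
  obtain ⟨s, hs, rfl⟩ := exists_lim_eq x
  obtain ⟨k, hk⟩ : ∃ k, 2 * 𝒮.e k < |s.1 k| := by
    by_contra! h
    exact hx (lim_eq_zero.2 ⟨2, h⟩)
  have h_near (i : N) := abs_le.1 (hs k i)
  have h_mono : 1 * 𝒮.e k ≤ 1 := (one_mul _).trans_le (𝒮.e_le_one k)
  refine ⟨shift k s, (hs.shift k).mono h_mono, lim_shift k s, 𝒮.e k, 𝒮.e_pos k, ?_⟩
  rcases lt_abs.1 hk with hk | hk
  · refine .inl fun i => ?_
    change _ ≤ s.1 (k + i)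
    linarith [(h_near i).2]
  · refine .inr fun i => ?_
    change _ ≤ -s.1 (k + i)
    linarith [(h_near i).1]

theorem Limit.nontrivial : Nontrivial 𝒮.Limit where
  exists_pair_ne := ⟨1, 0, fun h => notMem_null 𝒮 one_pos (fun _ => abs_one.ge)
    (lim_eq_zero.1 ((map_one 𝒮.lim).trans h))⟩

theorem Limit.exists_mul_eq_one {x : 𝒮.Limit} (hx : x ≠ 0) : ∃ y, x * y = 1 := by
  obtain ⟨s, hs, rfl, δ, hδ, h⟩ := exists_lim_eq_of_ne_zero hx
  have h_abs (k : N) : δ ≤ |s.1 k| := h.elim (fun h => (h k).trans (le_abs_self _))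
    fun h => (h k).trans (neg_le_abs _)
  have h_ne (k : N) : s.1 k ≠ 0 := abs_pos.1 (hδ.trans_le (h_abs k))
  refine ⟨𝒮.lim ⟨s.1⁻¹, 𝒮.inv_mem s.2.1 h_ne, _, hs.inv hδ h_abs⟩, ?_⟩
  rw [← map_mul, ← map_one 𝒮.lim]
  congr 1
  ext k
  exact mul_inv_cancel₀ (h_ne k)

noncomputable instance : Field 𝒮.Limit where
  __ := (inferInstance : CommRing 𝒮.Limit)
  __ := IsField.toField ⟨Limit.nontrivial.exists_pair_ne, mul_comm, Limit.exists_mul_eq_one⟩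

theorem exists_mul_self_eq_lim {s : 𝒮.convergent} (hs : 𝒮.ConvergesWith 1 s.1)
    (h : ∀ k, 0 ≤ s.1 k) : ∃ y, y * y = 𝒮.lim s := by
  obtain ⟨t, ht, h_approx⟩ := 𝒮.exists_approx_sqrt s.2.1 h
  refine ⟨𝒮.lim ⟨t, ht, 2, hs.approx_sqrt (fun k => (h_approx k).1) fun k => (h_approx k).2⟩, ?_⟩
  rw [← map_mul, lim_eq_lim]
  refine ⟨2, fun k => ?_⟩
  have h_sq := (h_approx k).2
  have h_shift := hs k k
  have h_e : 𝒮.e k * 𝒮.e k ≤ 𝒮.e k := mul_le_of_le_one_left (𝒮.e_pos k).le (𝒮.e_le_one k)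
  change |t k * t k - s.1 k| ≤ _
  rw [abs_le] at *
  constructor <;> linarith

theorem Limit.exists_mul_self_eq_or_eq_neg (x : 𝒮.Limit) : ∃ y, y * y = x ∨ y * y = -x := by
  rcases eq_or_ne x 0 with rfl | hx
  · exact ⟨0, .inl (mul_zero 0)⟩
  obtain ⟨s, hs, rfl, δ, hδ, h | h⟩ := exists_lim_eq_of_ne_zero hx
  · exact (exists_mul_self_eq_lim hs fun k => hδ.le.trans (h k)).imp fun _ => .inl
  · rw [← map_neg]
    exact (exists_mul_self_eq_lim (s := -s) hs.neg fun k => hδ.le.trans (h k)).imp fun _ => .inr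

theorem exists_lim_eq_of_isSumSq {x : 𝒮.Limit} (hx : IsSumSq x) :
    ∃ s : 𝒮.convergent, (∀ k, 0 ≤ s.1 k) ∧ 𝒮.lim s = x := by
  induction hx with
  | zero => exact ⟨0, fun _ => le_rfl, map_zero 𝒮.lim⟩
  | sq_add a _ ih =>
    obtain ⟨s, hs, rfl⟩ := ih
    obtain ⟨t, rfl⟩ := lim_surjective a
    exact ⟨t * t + s, fun k => add_nonneg (mul_self_nonneg (t.1 k)) (hs k),
      by rw [map_add, map_mul]⟩

instance : IsSemireal 𝒮.Limit where
  one_add_ne_zero hx h := by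
    obtain ⟨s, hs, rfl⟩ := exists_lim_eq_of_isSumSq hx
    rw [← map_one 𝒮.lim, ← map_add] at h
    refine notMem_null 𝒮 one_pos (fun k => ?_) (lim_eq_zero.1 h)
    exact (le_add_of_nonneg_right (hs k)).trans (le_abs_self _)

end SeqSpace

/-! ### Jordan decompositions over a field with square roots -/

section Jordan

theorem matrix_eq_iff {α : Type*} {a b c d a' b' c' d' : α} :
    !![a, b; c, d] = !![a', b'; c', d'] ↔ (a = a' ∧ b = b') ∧ c = c' ∧ d = d' := by
  simp [and_assoc]

variable {C : Type*} [Field C]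

/-- `J` consists of Jordan blocks: two of size one, or one of size two. -/
def IsJordan (J : Matrix (Fin 2) (Fin 2) C) : Prop :=
  J 1 0 = 0 ∧ (J 0 1 = 0 ∨ J 0 1 = 1 ∧ J 0 0 = J 1 1)

theorem isJordan_diagonal (x y : C) : IsJordan !![x, 0; 0, y] := ⟨rfl, .inl rfl⟩

theorem isJordan_block (x : C) : IsJordan !![x, 1; 0, x] := ⟨rfl, .inr ⟨rfl, rfl⟩⟩

theorem exists_add_eq_mul_eq [NeZero (2 : C)] (hsq : ∀ z : C, IsSquare z) (p q : C) :
    ∃ x y, x + y = p ∧ x * y = q := by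
  have h2 : (2 : C) ≠ 0 := NeZero.ne 2
  obtain ⟨r, hr⟩ := hsq (p * p - 4 * q)
  refine ⟨(p + r) / 2, (p - r) / 2, by field_simp; ring, ?_⟩
  field_simp
  linear_combination hr

theorem exists_mul_eq_mul_isJordan_of_lower (a c d : C) :
    ∃ U J, U.det ≠ 0 ∧ IsJordan J ∧ !![a, 0; c, d] * U = U * J := by
  by_cases had : a = d
  · subst had
    by_cases hc : c = 0
    · exact ⟨1, _, by simp, isJordan_diagonal a a, by simp [hc]⟩
    · exact ⟨!![0, 1; c, 0], _, by simpa using hc, isJordan_block a, by simp [mul_comm]⟩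
  · refine ⟨!![0, a - d; 1, c], _, ?_, isJordan_diagonal d a, ?_⟩
    · simpa [sub_eq_zero, eq_comm] using had
    rw [Matrix.mul_fin_two, Matrix.mul_fin_two, matrix_eq_iff]
    refine ⟨⟨?_, ?_⟩, ?_, ?_⟩ <;> ring

/-- If the eigenvalues `x` and `y` are different, the columns of `U` are eigenvectors. -/
theorem exists_mul_eq_mul_isJordan {a b c d x y : C} (hb : b ≠ 0) (htr : x + y = a + d)
    (hdet : x * y = a * d - b * c) :
    ∃ U J, U.det ≠ 0 ∧ IsJordan J ∧ !![a, b; c, d] * U = U * J := by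
  obtain rfl : d = x + y - a := by linear_combination -htr
  by_cases hxy : x = y
  · subst hxy
    refine ⟨!![b, 0; x - a, 1], _, by simpa using hb, isJordan_block x, ?_⟩
    rw [Matrix.mul_fin_two, Matrix.mul_fin_two, matrix_eq_iff]
    exact ⟨⟨by ring, by ring⟩, by linear_combination hdet, by ring⟩
  · refine ⟨!![b, b; x - a, y - a], _, ?_, isJordan_diagonal x y, ?_⟩
    · rw [Matrix.det_fin_two_of, show b * (y - a) - b * (x - a) = b * (y - x) by ring]
      exact mul_ne_zero hb (sub_ne_zero.2 (Ne.symm hxy))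
    rw [Matrix.mul_fin_two, Matrix.mul_fin_two, matrix_eq_iff]
    exact ⟨⟨by ring, by ring⟩, by linear_combination hdet, by linear_combination hdet⟩

theorem exists_jordan [NeZero (2 : C)] (hsq : ∀ z : C, IsSquare z)
    (M : Matrix (Fin 2) (Fin 2) C) :
    ∃ U J V, U * V = 1 ∧ V * U = 1 ∧ IsJordan J ∧ M = U * J * V := by
  obtain ⟨U, J, hU, hJ, h⟩ : ∃ U J, U.det ≠ 0 ∧ IsJordan J ∧ M * U = U * J := by
    rw [Matrix.eta_fin_two M]
    by_cases hb : M 0 1 = 0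
    · rw [hb]
      exact exists_mul_eq_mul_isJordan_of_lower _ _ _
    · obtain ⟨x, y, htr, hdet⟩ := exists_add_eq_mul_eq hsq (M 0 0 + M 1 1) M.det
      exact exists_mul_eq_mul_isJordan hb htr (hdet.trans M.det_fin_two)
  have hVU : U * U⁻¹ = 1 := Matrix.mul_nonsing_inv U hU.isUnit
  refine ⟨U, J, U⁻¹, hVU, Matrix.nonsing_inv_mul U hU.isUnit, hJ, ?_⟩
  rw [← h, mul_assoc, hVU, mul_one]

end Jordan

/-! ### Complex numbers -/

/-- The complex numbers over `R`. -/
abbrev Cplx (R : Type*) [CommRing R] : Type _ := QuadraticAlgebra R (-1) 0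

namespace Cplx

variable {R : Type*} [Field R]

theorem mul_self_eq_iff {w : Cplx R} {a b : R} :
    w * w = ⟨a, b⟩ ↔ w.re * w.re - w.im * w.im = a ∧ 2 * w.re * w.im = b := by
  rw [QuadraticAlgebra.ext_iff, QuadraticAlgebra.re_mul, QuadraticAlgebra.im_mul]
  refine and_congr ?_ ?_ <;> ring_nf

variable [IsSemireal R]

instance : Fact (∀ r : R, r ^ 2 ≠ -1 + 0 * r) where
  out r h := IsSemireal.one_add_ne_zero (IsSumSq.mul_self r) (by linear_combination h)

instance : CharZero (Cplx R) := charZero_of_injective_algebraMap (algebraMap R (Cplx R)).injective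

theorem exists_mul_self_eq_sq_add_sq (hsq : ∀ x : R, ∃ y, y * y = x ∨ y * y = -x) (a : R) {b : R}
    (hb : b ≠ 0) : ∃ r, r * r = a * a + b * b := by
  obtain ⟨r, hr | hr⟩ := hsq (a * a + b * b)
  · exact ⟨r, hr⟩
  · refine (IsSemireal.one_add_ne_zero
      ((IsSumSq.mul_self (a / b)).add (IsSumSq.mul_self (r / b))) ?_).elim
    field_simp
    linear_combination hr

/-- With `r² = a² + b²`, one of `(r + a) / 2` and `(-r - a) / 2` is a square. In the first case it
is the square of the real part of a square root of `a + b i`, in the second case it is the square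
of the imaginary part. -/
theorem isSquare (hsq : ∀ x : R, ∃ y, y * y = x ∨ y * y = -x) (z : Cplx R) : IsSquare z := by
  obtain ⟨a, b⟩ := z
  suffices h : ∃ x y : R, x * x - y * y = a ∧ 2 * x * y = b by
    obtain ⟨x, y, h⟩ := h
    exact ⟨⟨x, y⟩, (mul_self_eq_iff.2 h).symm⟩
  rcases eq_or_ne b 0 with rfl | hb
  · obtain ⟨y, hy | hy⟩ := hsq a
    · exact ⟨y, 0, by linear_combination hy, by ring⟩
    · exact ⟨0, y, by linear_combination -hy, by ring⟩
  obtain ⟨r, hr⟩ := exists_mul_self_eq_sq_add_sq hsq a hb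
  obtain ⟨y, hy⟩ := hsq ((r + a) / 2)
  have hy0 : y ≠ 0 := by
    rintro rfl
    have hra : r + a = 0 := by
      rcases hy with hy | hy <;> field_simp at hy
      exacts [by linear_combination -hy, by linear_combination hy]
    exact hb (mul_self_eq_zero.1 (by linear_combination (r - a) * hra - hr))
  rcases hy with hy | hy <;> field_simp at hy
  · refine ⟨y, b / (2 * y), ?_, by field_simp⟩
    field_simp
    linear_combination (2 * y ^ 2 - a + r) * hy + hr
  · refine ⟨b / (2 * y), y, ?_, by field_simp⟩
    field_simp
    linear_combination -hr - (2 * y ^ 2 + a - r) * hy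

end Cplx

namespace Henkin

variable {T : Formula → Prop} {hT : Henkin RCA₀ T}

/-! ### Pairing of numbers -/

theorem tri_mono : Monotone hT.tri := fun x y h => by
  obtain ⟨c, rfl⟩ := exists_add_of_le h
  clear h
  induction c using QF.induction with
  | hP => exact .le (.const _) (.tri (.add (.const x) .fst))
  | zero => rw [add_zero]
  | succ c ih =>
    rw [← add_assoc, tri_succ]
    exact le_add_right ih

theorem triRoot_spec (x : hT.Num) :
    hT.tri (hT.triRoot x) ≤ x ∧ x < hT.tri (hT.triRoot x + 1) := by
  induction x using QF.induction with
  | hP =>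
    exact .and (.le (.tri (.triRoot .fst)) .fst) (.lt .fst (.tri (.add (.triRoot .fst) (.const 1))))
  | zero =>
    rw [triRoot_zero, tri_succ, tri_zero, zero_add, zero_add]
    exact ⟨le_rfl, zero_lt_one⟩
  | succ x ih =>
    obtain ⟨ih₁, ih₂⟩ := ih
    rw [triRoot_succ]
    obtain h | h := le_or_gt (hT.tri (hT.triRoot x + 1)) (x + 1)
    · rw [tsub_eq_zero_of_le h, tsub_zero]
      refine ⟨h, ?_⟩
      rw [tri_succ (_ + 1)]
      calc x + 1 < hT.tri (hT.triRoot x + 1) + 1 := by gcongr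
        _ ≤ hT.tri (hT.triRoot x + 1) + (hT.triRoot x + 1 + 1) := by gcongr; exact le_add_self
    · rw [tsub_eq_zero_of_le (Order.one_le_iff_pos.2 (tsub_pos_of_lt h)), add_zero]
      exact ⟨ih₁.trans le_self_add, h⟩

theorem triRoot_tri_add {w y : hT.Num} (h : y ≤ w) : hT.triRoot (hT.tri w + y) = w := by
  obtain ⟨h₁, h₂⟩ := triRoot_spec (hT.tri w + y)
  refine le_antisymm (Order.lt_add_one_iff.1 (tri_mono.reflect_lt (h₁.trans_lt ?_)))
    (Order.lt_add_one_iff.1 (tri_mono.reflect_lt (le_self_add.trans_lt h₂)))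
  rw [tri_succ]
  gcongr
  exact Order.lt_add_one_iff.2 h

variable (hT) in
/-- The Cantor pairing in the term model. -/
def pair (x y : hT.Num) : hT.Num := hT.tri (x + y) + y

variable (hT) in
/-- The second component of a pair in the term model. -/
def right (x : hT.Num) : hT.Num := x - hT.tri (hT.triRoot x)

variable (hT) in
/-- The first component of a pair in the term model. -/
def left (x : hT.Num) : hT.Num := hT.triRoot x - hT.right x

theorem right_pair (x y : hT.Num) : hT.right (hT.pair x y) = y := by
  rw [right, pair, triRoot_tri_add le_add_self, add_tsub_cancel_left]

theorem left_pair (x y : hT.Num) : hT.left (hT.pair x y) = x := by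
  rw [left, right_pair, pair, triRoot_tri_add le_add_self, add_tsub_cancel_right]

/-! ### The rational numbers of the term model -/

variable (hT) in
/-- The rational numbers of the term model. -/
abbrev Rat : Type := Frac hT.Num

variable (hT) in
/-- The embedding of the numbers into the rational numbers of the term model. -/
noncomputable abbrev ι : hT.Num →+* hT.Rat := Frac.of hT.Num

theorem twoPow_add (x y : hT.Num) : hT.twoPow (x + y) = hT.twoPow x * hT.twoPow y := by
  induction y using QF.induction with
  | hP =>
    exact .eq (.twoPow (.add (.const _) .fst)) (.mul (.const _) (.twoPow .fst))
  | zero => rw [add_zero, twoPow_zero, mul_one]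
  | succ y ih => rw [← add_assoc, twoPow_succ, twoPow_succ, ih, mul_add]

theorem add_one_le_twoPow (x : hT.Num) : x + 1 ≤ hT.twoPow x := by
  induction x using QF.induction with
  | hP => exact .le (.add .fst (.const 1)) (.twoPow .fst)
  | zero => rw [zero_add, twoPow_zero]
  | succ x ih =>
    rw [twoPow_succ]
    exact add_le_add ih (le_add_self.trans ih)

theorem one_le_twoPow (x : hT.Num) : 1 ≤ hT.twoPow x := le_add_self.trans (add_one_le_twoPow x)

theorem one_le_ι {n : hT.Num} : 1 ≤ hT.ι n ↔ 1 ≤ n := by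
  rw [← map_one hT.ι, Frac.of_strictMono.le_iff_le]

variable (hT) in
/-- The rational number `2⁻ⁿ` of the term model. -/
noncomputable def e (n : hT.Num) : hT.Rat := (hT.ι (hT.twoPow n))⁻¹

theorem e_pos (n : hT.Num) : 0 < hT.e n :=
  inv_pos.2 (zero_lt_one.trans_le (one_le_ι.2 (one_le_twoPow n)))

theorem e_le_one (n : hT.Num) : hT.e n ≤ 1 :=
  inv_le_one_of_one_le₀ (one_le_ι.2 (one_le_twoPow n))

theorem e_add (m n : hT.Num) : hT.e (m + n) = hT.e m * hT.e n := by
  rw [e, twoPow_add, map_mul, mul_inv, e, e]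

theorem two_mul_e_one : 2 * hT.e 1 = 1 := by
  have h : hT.twoPow 1 = 1 + 1 := by rw [← zero_add 1, twoPow_succ, twoPow_zero, zero_add]
  rw [e, h, map_add, map_one, one_add_one_eq_two, mul_inv_cancel₀ two_ne_zero]

theorem exists_le_ι (x : hT.Rat) : ∃ n, x ≤ hT.ι n := by
  obtain hx | hx := le_total x 0
  · exact ⟨0, hx.trans (Frac.of_nonneg 0)⟩
  · obtain ⟨a, b, hb, rfl⟩ := Frac.nonneg_iff.1 hx
    exact ⟨a, div_le_self (Frac.of_nonneg a) (one_le_ι.2 (Order.one_le_iff_ne_zero.2 hb))⟩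

theorem exists_e_lt (x : hT.Rat) (hx : 0 < x) : ∃ n, hT.e n < x := by
  obtain ⟨n, hn⟩ := exists_le_ι x⁻¹
  refine ⟨n, inv_lt_of_inv_lt₀ hx (hn.trans_lt ?_)⟩
  have h := Frac.of_strictMono.le_iff_le.2 (add_one_le_twoPow n)
  rw [map_add, map_one] at h
  exact (lt_add_one _).trans_le h

theorem e_mul_ι_le_one (n : hT.Num) : hT.e n * hT.ι n ≤ 1 :=
  inv_mul_le_one_of_le₀ (Frac.of_strictMono.monotone (le_self_add.trans (add_one_le_twoPow n)))
    (Frac.of_nonneg _)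

theorem exists_sq_le_lt (m : hT.Num) : ∃ n, n * n ≤ m ∧ m < (n + 1) * (n + 1) := by
  by_contra! H
  have hsq (n : hT.Num) : n * n ≤ m := by
    induction n using QF.induction with
    | hP => exact .le (.mul .fst .fst) (.const m)
    | zero => rw [mul_zero]; exact zero_le
    | succ n ih => exact H n ih
  refine (Order.lt_add_one_iff.2 le_rfl).not_ge ((hsq (m + 1)).trans' ?_)
  rw [mul_add, mul_one]
  exact le_add_self

end Henkin

theorem abs_mul_self_sub_le {K : Type*} [Field K] [LinearOrder K] [IsStrictOrderedRing K]
    {x q δ ε : K} (hq : 0 ≤ q) (hδ : 0 ≤ δ) (hδ₁ : δ ≤ 1) (hqx : q * q ≤ x)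
    (hxq : x < (q + δ) * (q + δ)) (hε : (2 * x + 3) * δ ≤ ε) : |q * q - x| ≤ ε := by
  have hq₁ : q ≤ x + 1 := by nlinarith
  rw [abs_of_nonpos (sub_nonpos.2 hqx)]
  nlinarith

theorem Henkin.exists_approx_sqrt {T : Formula → Prop} {hT : Henkin RCA₀ T} {x ε : hT.Rat}
    (hx : 0 ≤ x) (hε : 0 < ε) : ∃ q, 0 ≤ q ∧ |q * q - x| ≤ ε := by
  obtain ⟨d, c, hc, rfl⟩ := Frac.nonneg_iff.1 hx
  obtain ⟨D, hD⟩ := exists_le_ι ((2 * (hT.ι d / hT.ι c) + 3) / ε)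
  have hc₁ : 1 ≤ hT.ι c := one_le_ι.2 (Order.one_le_iff_ne_zero.2 hc)
  have hD₁ : 1 ≤ hT.ι D := one_le_ι.2 <| Order.one_le_iff_ne_zero.2 fun h => by
    rw [h, map_zero] at hD
    exact hD.not_gt (by positivity)
  have hcD : 1 ≤ hT.ι c * hT.ι D := one_le_mul_of_one_le_of_one_le hc₁ hD₁
  have hcD₀ : 0 < hT.ι c * hT.ι D := by positivity
  have hdc : hT.ι d / hT.ι c = hT.ι (d * c * (D * D)) / (hT.ι c * hT.ι D * (hT.ι c * hT.ι D)) := by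
    simp only [map_mul]
    field_simp
  obtain ⟨n, hn, hn'⟩ := exists_sq_le_lt (d * c * (D * D))
  replace hn := Frac.of_strictMono.monotone hn
  replace hn' := Frac.of_strictMono hn'
  rw [map_mul] at hn
  rw [map_mul _ (n + 1), map_add, map_one] at hn'
  have hq : 0 ≤ hT.ι n / (hT.ι c * hT.ι D) := div_nonneg (Frac.of_nonneg n) hcD₀.le
  refine ⟨hT.ι n / (hT.ι c * hT.ι D), hq, abs_mul_self_sub_le (δ := 1 / (hT.ι c * hT.ι D)) hq
    (one_div_nonneg.2 hcD₀.le) (div_le_one_of_le₀ hcD hcD₀.le) ?_ ?_ ?_⟩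
  · rw [hdc, div_mul_div_comm]
    gcongr
  · rw [hdc, ← add_div, div_mul_div_comm]
    gcongr
  · rw [mul_one_div, div_le_comm₀ hcD₀ hε]
    exact hD.trans (le_mul_of_one_le_left (by positivity) hc₁)

/-! ### Codes of rational numbers -/

theorem subst_and (φ ψ : Formula) (σ : Sub) :
    (φ.and ψ).subst σ = (φ.subst σ).and (ψ.subst σ) := rfl

section

variable (t u v : Term .num) (σ : Sub)

theorem subst_qMk : (qMk t u v).subst σ = qMk (t.subst σ) (u.subst σ) (v.subst σ) := rfl

theorem subst_qAdd : (qAdd t u).subst σ = qAdd (t.subst σ) (u.subst σ) := rfl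

theorem subst_qMul : (qMul t u).subst σ = qMul (t.subst σ) (u.subst σ) := rfl

theorem subst_qOpp : (qOpp t).subst σ = qOpp (t.subst σ) := rfl

theorem subst_qDyadic : (qDyadic t u).subst σ = qDyadic (t.subst σ) (u.subst σ) := rfl

theorem subst_qBound : (qBound t).subst σ = qBound (t.subst σ) := rfl

theorem subst_qLe : (qLe t u).subst σ = qLe (t.subst σ) (u.subst σ) := rfl

theorem subst_qDistLe :
    (qDistLe t u v).subst σ = qDistLe (t.subst σ) (u.subst σ) (v.subst σ) := by
  simp only [qDistLe, subst_and, subst_qLe, subst_qAdd]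

end

namespace Henkin

variable {T : Formula → Prop} {hT : Henkin RCA₀ T}

variable (hT) in
/-- The rational number of the term model with a given code. -/
noncomputable def val (q : hT.Num) : hT.Rat :=
  (hT.ι (hT.left (hT.left q)) - hT.ι (hT.right (hT.left q))) / hT.ι (hT.right q + 1)

variable (hT)

theorem den_right (t : Term .num) : hT.den (RCA.right t) = hT.right (hT.den t) := rfl

theorem den_qPos (q : Term .num) : hT.den (qPos q) = hT.left (hT.left (hT.den q)) := rfl

theorem den_qNeg (q : Term .num) : hT.den (qNeg q) = hT.right (hT.left (hT.den q)) := rfl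

theorem den_qDen (q : Term .num) : hT.den (qDen q) = hT.right (hT.den q) + 1 := hT.den_succ _

theorem den_qMk (a b c : Term .num) :
    hT.den (qMk a b c) = hT.pair (hT.pair (hT.den a) (hT.den b)) (hT.den c) := rfl

theorem val_den (q : Term .num) :
    hT.val (hT.den q) =
      (hT.ι (hT.den (qPos q)) - hT.ι (hT.den (qNeg q))) / hT.ι (hT.den (qDen q)) := by
  rw [val, den_qPos, den_qNeg, den_qDen]

theorem val_den_qMk (a b c : Term .num) :
    hT.val (hT.den (qMk a b c)) = (hT.ι (hT.den a) - hT.ι (hT.den b)) / hT.ι (hT.den c + 1) := by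
  rw [den_qMk, val, left_pair, right_pair, left_pair, right_pair]

theorem one_le_den_qDen (q : Term .num) : 1 ≤ hT.den (qDen q) := by
  rw [den_qDen]
  exact le_add_self

theorem ι_den_qDen_pos (q : Term .num) : 0 < hT.ι (hT.den (qDen q)) :=
  zero_lt_one.trans_le (one_le_ι.2 (hT.one_le_den_qDen q))

theorem den_pred_qDen_mul_qDen_add_one (p q : Term .num) :
    hT.den (pred (mul (qDen p) (qDen q))) + 1 = hT.den (qDen p) * hT.den (qDen q) := by
  rw [den_pred, den_mul, tsub_add_cancel_of_le]
  exact one_le_mul (hT.one_le_den_qDen p) (hT.one_le_den_qDen q)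

theorem val_den_qAdd (p q : Term .num) :
    hT.val (hT.den (qAdd p q)) = hT.val (hT.den p) + hT.val (hT.den q) := by
  rw [qAdd, val_den_qMk, den_pred_qDen_mul_qDen_add_one, val_den, val_den,
    div_add_div _ _ (hT.ι_den_qDen_pos p).ne' (hT.ι_den_qDen_pos q).ne']
  simp only [den_add, den_mul, map_add, map_mul]
  ring

theorem val_den_qMul (p q : Term .num) :
    hT.val (hT.den (qMul p q)) = hT.val (hT.den p) * hT.val (hT.den q) := by
  rw [qMul, val_den_qMk, den_pred_qDen_mul_qDen_add_one, val_den, val_den, div_mul_div_comm]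
  simp only [den_add, den_mul, map_add, map_mul]
  ring

theorem val_den_qOpp (q : Term .num) : hT.val (hT.den (qOpp q)) = -hT.val (hT.den q) := by
  rw [qOpp, val_den_qMk, val_den, den_qDen, den_right, ← neg_div, neg_sub]

theorem val_den_qDyadic (t k : Term .num) :
    hT.val (hT.den (qDyadic t k)) = hT.ι (hT.den t) * hT.e (hT.den k) := by
  rw [qDyadic, val_den_qMk, den_pred, den_twoPow, tsub_add_cancel_of_le (one_le_twoPow _), den_zero,
    map_zero, sub_zero, e, div_eq_mul_inv]

theorem qLe_iff {p q : Term .num} : T (qLe p q) ↔ hT.val (hT.den p) ≤ hT.val (hT.den q) := by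
  rw [qLe, le, hT.eq_iff, den_monus, den_zero, tsub_eq_zero_iff_le, val_den, val_den,
    div_le_div_iff₀ (hT.ι_den_qDen_pos p) (hT.ι_den_qDen_pos q), sub_mul, sub_mul, sub_le_sub_iff]
  simp only [den_add, den_mul, ← map_mul, ← map_add, Frac.of_strictMono.le_iff_le]

theorem qDistLe_iff {p q r : Term .num} :
    T (qDistLe p q r) ↔ |hT.val (hT.den p) - hT.val (hT.den q)| ≤ hT.val (hT.den r) := by
  rw [qDistLe, hT.and_iff, hT.qLe_iff, hT.qLe_iff, val_den_qAdd, val_den_qAdd, abs_sub_le_iff,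
    sub_le_iff_le_add', sub_le_iff_le_add']

theorem abs_val_den_le (q : Term .num) : |hT.val (hT.den q)| ≤ hT.ι (hT.den (qBound q)) := by
  have h₁ : 0 ≤ hT.ι (hT.den (qPos q)) := Frac.of_nonneg _
  have h₂ : 0 ≤ hT.ι (hT.den (qNeg q)) := Frac.of_nonneg _
  calc |hT.val (hT.den q)|
      = |hT.ι (hT.den (qPos q)) - hT.ι (hT.den (qNeg q))| / hT.ι (hT.den (qDen q)) := by
        rw [val_den, abs_div, abs_of_pos (hT.ι_den_qDen_pos q)]
    _ ≤ |hT.ι (hT.den (qPos q)) - hT.ι (hT.den (qNeg q))| :=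
        div_le_self (abs_nonneg _) (one_le_ι.2 (hT.one_le_den_qDen q))
    _ ≤ hT.ι (hT.den (qPos q)) + hT.ι (hT.den (qNeg q)) := by
        rw [abs_sub_le_iff]
        constructor <;> linarith
    _ = hT.ι (hT.den (qBound q)) := by rw [qBound, den_add, map_add]

theorem val_surjective : Function.Surjective hT.val := fun x => by
  obtain ⟨a, b, hb, hx⟩ := Frac.exists_eq_div_or_neg_eq_div x
  obtain ⟨t, rfl⟩ := hT.den_surjective a
  obtain ⟨u, rfl⟩ := hT.den_surjective b
  have hu := tsub_add_cancel_of_le (Order.one_le_iff_ne_zero.2 hb)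
  obtain rfl | hx := hx
  · exact ⟨hT.den (qMk t zero (pred u)), by
      rw [val_den_qMk, den_pred, hu, den_zero, map_zero, sub_zero]⟩
  · exact ⟨hT.den (qMk zero t (pred u)), by
      rw [val_den_qMk, den_pred, hu, den_zero, map_zero, zero_sub, neg_div, ← hx, neg_neg]⟩

end Henkin

namespace Henkin

variable {T : Formula → Prop} {hT : Henkin RCA₀ T}

/-! ### Definable sequences of rational numbers -/

variable (hT) in
/-- The sequence of rational numbers coded by a function term. -/
noncomputable def seq (f : Term .fn) (n : hT.Num) : hT.Rat := hT.val (hT.app f n)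

variable (hT) in
/-- Binary functions from numbers to rational numbers such that a term defines codes of their
values. -/
def DefRat (g : hT.Num → hT.Num → hT.Rat) : Prop := ∃ h, hT.Def h ∧ (fun x y => hT.val (h x y)) = g

section

variable {h : hT.Num → hT.Num → hT.Num} {g g' : hT.Num → hT.Num → hT.Rat}

theorem DefRat.val (hh : hT.Def h) : hT.DefRat fun x y => hT.val (h x y) := ⟨h, hh, rfl⟩

theorem DefRat.seq (f : Term .fn) (hh : hT.Def h) : hT.DefRat fun x y => hT.seq f (h x y) :=
  .val (hh.app f)

theorem DefRat.e (hh : hT.Def h) : hT.DefRat fun x y => hT.e (h x y) := by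
  refine ⟨_, .map₂ (qDyadic (nv 0) (nv 1)) (.const 1) hh, funext₂ fun x y => ?_⟩
  obtain ⟨t, ht⟩ := hT.den_surjective (h x y)
  rw [← ht, ← den_one, map₂_den]
  exact (hT.val_den_qDyadic one t).trans (by rw [den_one, map_one, one_mul])

theorem DefRat.const (x : hT.Rat) : hT.DefRat fun _ _ => x := by
  obtain ⟨q, rfl⟩ := hT.val_surjective x
  exact .val (.const q)

theorem DefRat.map₂ {s : Term .num} {F : hT.Rat → hT.Rat → hT.Rat}
    (hF : ∀ p q, hT.val (hT.den (s.subst (Sub.double p q))) =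
      F (hT.val (hT.den p)) (hT.val (hT.den q)))
    (hg : hT.DefRat g) (hg' : hT.DefRat g') : hT.DefRat fun x y => F (g x y) (g' x y) := by
  obtain ⟨h, hh, rfl⟩ := hg
  obtain ⟨h', hh', rfl⟩ := hg'
  refine ⟨_, .map₂ s hh hh', funext₂ fun x y => ?_⟩
  obtain ⟨p, hp⟩ := hT.den_surjective (h x y)
  obtain ⟨q, hq⟩ := hT.den_surjective (h' x y)
  beta_reduce
  rw [← hp, ← hq, map₂_den, hF]

theorem DefRat.add (hg : hT.DefRat g) (hg' : hT.DefRat g') : hT.DefRat fun x y => g x y + g' x y :=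
  .map₂ (s := qAdd (nv 0) (nv 1)) hT.val_den_qAdd hg hg'

theorem DefRat.mul (hg : hT.DefRat g) (hg' : hT.DefRat g') : hT.DefRat fun x y => g x y * g' x y :=
  .map₂ (s := qMul (nv 0) (nv 1)) hT.val_den_qMul hg hg'

theorem DefRat.neg (hg : hT.DefRat g) : hT.DefRat fun x y => -g x y :=
  .map₂ (s := qOpp (nv 0)) (F := fun p _ => -p) (fun p _ => hT.val_den_qOpp p) hg hg

theorem QF.rat_le (hg : hT.DefRat g) (hg' : hT.DefRat g') : hT.QF fun x y => g x y ≤ g' x y := by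
  obtain ⟨_, ⟨s, rfl⟩, rfl⟩ := hg
  obtain ⟨_, ⟨s', rfl⟩, rfl⟩ := hg'
  exact ⟨qLe s s', trivial, fun t u => hT.qLe_iff⟩

theorem QF.rat_eq (hg : hT.DefRat g) (hg' : hT.DefRat g') : hT.QF fun x y => g x y = g' x y := by
  simpa only [le_antisymm_iff] using (rat_le hg hg').and (rat_le hg' hg)

theorem QF.rat_abs_le (hg : hT.DefRat g) (hg' : hT.DefRat g') :
    hT.QF fun x y => |g x y| ≤ g' x y := by
  simpa only [abs_le] using (rat_le hg'.neg hg).and (rat_le hg hg')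

end

theorem DefRat.exists_seq_eq {g : hT.Num → hT.Rat} (hg : hT.DefRat fun x _ => g x) :
    ∃ f, hT.seq f = g := by
  obtain ⟨_, ⟨s, rfl⟩, hg⟩ := hg
  have hs : hT.Def fun x _ => hT.map₂ s x 0 := .map₂ s .fst (.const 0)
  obtain ⟨f, hf⟩ := hs.exists_app_eq
  refine ⟨f, funext fun x => ?_⟩
  rw [Henkin.seq, hf, ← congrFun₂ hg x 0]

theorem QF.rat_choice {P : hT.Rat → hT.Num → Prop} (hP : hT.QF fun y x => P (hT.val y) x)
    (h : ∀ x, ∃ q, P q x) : ∃ f, ∀ x, P (hT.seq f x) x :=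
  hP.choice fun x => hT.val_surjective.exists.1 (h x)

variable (hT) in
/-- The ring of sequences of rational numbers that are coded by function terms. -/
noncomputable def seqs : Subring (hT.Num → hT.Rat) where
  carrier := Set.range hT.seq
  zero_mem' := (DefRat.const 0).exists_seq_eq
  one_mem' := (DefRat.const 1).exists_seq_eq
  add_mem' := by
    rintro _ _ ⟨f, rfl⟩ ⟨g, rfl⟩
    exact ((DefRat.seq f .fst).add (DefRat.seq g .fst)).exists_seq_eq
  mul_mem' := by
    rintro _ _ ⟨f, rfl⟩ ⟨g, rfl⟩
    exact ((DefRat.seq f .fst).mul (DefRat.seq g .fst)).exists_seq_eq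
  neg_mem' := by
    rintro _ ⟨f, rfl⟩
    exact (DefRat.seq f .fst).neg.exists_seq_eq

theorem inv_mem_seqs {s : hT.Num → hT.Rat} (hs : s ∈ hT.seqs) (h₀ : ∀ k, s k ≠ 0) :
    s⁻¹ ∈ hT.seqs := by
  obtain ⟨f, rfl⟩ := hs
  have hP : hT.QF fun y x => hT.val y * hT.seq f x = 1 :=
    .rat_eq (.mul (.val .fst) (.seq f .snd)) (.const 1)
  obtain ⟨g, hg⟩ := hP.rat_choice (P := fun q x => q * hT.seq f x = 1)
    fun x => ⟨_, inv_mul_cancel₀ (h₀ x)⟩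
  exact ⟨g, funext fun x => eq_inv_of_mul_eq_one_left (hg x)⟩

theorem exists_approx_sqrt_mem_seqs {s : hT.Num → hT.Rat} (hs : s ∈ hT.seqs) (h₀ : ∀ k, 0 ≤ s k) :
    ∃ t ∈ hT.seqs, ∀ k, 0 ≤ t k ∧ |t k * t k - s (k + k)| ≤ hT.e k * hT.e k := by
  obtain ⟨f, rfl⟩ := hs
  have hP : hT.QF fun y x => 0 ≤ hT.val y ∧
      |hT.val y * hT.val y + -hT.seq f (x + x)| ≤ hT.e x * hT.e x :=
    .and (.rat_le (.const 0) (.val .fst)) <| .rat_abs_le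
      (.add (.mul (.val .fst) (.val .fst)) (.neg (.seq f (.add .snd .snd))))
      (.mul (.e .snd) (.e .snd))
  simp only [← sub_eq_add_neg] at hP
  obtain ⟨g, hg⟩ := hP.rat_choice
    (P := fun q x => 0 ≤ q ∧ |q * q - hT.seq f (x + x)| ≤ hT.e x * hT.e x)
    fun x => exists_approx_sqrt (h₀ (x + x)) (mul_pos (e_pos x) (e_pos x))
  exact ⟨_, ⟨g, rfl⟩, hg⟩

variable (hT) in
/-- The sequences of rational numbers of the term model, as a ring in which real numbers can be
constructed. -/
noncomputable def seqSpace : SeqSpace hT.Num hT.Rat where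
  e := hT.e
  e_add := e_add
  e_pos := e_pos
  e_le_one := e_le_one
  exists_e_lt := exists_e_lt
  seqs := hT.seqs
  shift_mem := by
    rintro _ m ⟨f, rfl⟩
    exact (DefRat.seq f (.add (.const m) .fst)).exists_seq_eq
  inv_mem := inv_mem_seqs
  exists_approx_sqrt := exists_approx_sqrt_mem_seqs

end Henkin

/-! ### Substitution in the formulas about real numbers, complex numbers and matrices -/

theorem subst_or (φ ψ : Formula) (σ : Sub) : (φ.or ψ).subst σ = (φ.subst σ).or (ψ.subst σ) := rfl

section Real

variable (f g : Term .fn) (σ : Sub)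

theorem subst_isReal : (isReal f).subst σ = isReal (f.subst σ) := by
  simp only [isReal, Formula.subst, subst_qDistLe, Term.subst, Term.lift_subst_up, subst_qDyadic]
  rfl

theorem subst_rEq : (rEq f g).subst σ = rEq (f.subst σ) (g.subst σ) := by
  simp only [rEq, Formula.subst, subst_qDistLe, Term.subst, Term.lift_subst_up, subst_qDyadic]
  rfl

theorem subst_rAdd : (rAdd f g).subst σ = rAdd (f.subst σ) (g.subst σ) := by
  simp only [rAdd, Term.subst, Term.lift_subst_up, subst_qAdd]
  rfl

theorem subst_rOpp : (rOpp f).subst σ = rOpp (f.subst σ) := by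
  simp only [rOpp, Term.subst, Term.lift_subst_up, subst_qOpp]
  rfl

theorem subst_rMul : (rMul f g).subst σ = rMul (f.subst σ) (g.subst σ) := by
  simp only [rMul, Term.subst, Term.lift_subst_up, subst_qMul, subst_qBound, one]
  rfl

end Real

/-- Substitution in the real and the imaginary part of a complex number. -/
def CTerm.subst (z : CTerm) (σ : Sub) : CTerm := ⟨z.re.subst σ, z.im.subst σ⟩

/-- Substitution in the entries of a matrix. -/
def MTerm.subst (A : MTerm) (σ : Sub) : MTerm :=
  ⟨A.a.subst σ, A.b.subst σ, A.c.subst σ, A.d.subst σ⟩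

section Complex

variable (z w : CTerm) (A B : MTerm) (σ : Sub)

theorem subst_isComplex : (isComplex z).subst σ = isComplex (z.subst σ) := by
  simp only [isComplex, subst_and, subst_isReal, CTerm.subst]

theorem subst_cEq : (cEq z w).subst σ = cEq (z.subst σ) (w.subst σ) := by
  simp only [cEq, subst_and, subst_rEq, CTerm.subst]

theorem subst_cZero : cZero.subst σ = cZero := rfl

theorem subst_cOne : cOne.subst σ = cOne := rfl

theorem subst_cAdd : (cAdd z w).subst σ = cAdd (z.subst σ) (w.subst σ) := by
  simp only [cAdd, CTerm.subst, subst_rAdd]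

theorem subst_cMul : (cMul z w).subst σ = cMul (z.subst σ) (w.subst σ) := by
  simp only [cMul, CTerm.subst, subst_rAdd, subst_rMul, subst_rOpp]

theorem subst_isMatrix : (isMatrix A).subst σ = isMatrix (A.subst σ) := by
  simp only [isMatrix, subst_and, subst_isComplex, MTerm.subst]

theorem subst_mEq : (mEq A B).subst σ = mEq (A.subst σ) (B.subst σ) := by
  simp only [mEq, subst_and, subst_cEq, MTerm.subst]

theorem subst_mOne : mOne.subst σ = mOne := rfl

theorem subst_mMul : (mMul A B).subst σ = mMul (A.subst σ) (B.subst σ) := by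
  simp only [mMul, MTerm.subst, subst_cAdd, subst_cMul]

theorem subst_isInverse : (isInverse A B).subst σ = isInverse (A.subst σ) (B.subst σ) := by
  simp only [isInverse, subst_and, subst_mEq, subst_mMul, subst_mOne]

theorem subst_isJordan : (isJordan A).subst σ = isJordan (A.subst σ) := by
  simp only [isJordan, subst_and, subst_or, subst_cEq, subst_cZero, subst_cOne, MTerm.subst]

end Complex

/-! ### Blocks of function quantifiers -/

/-- Assign `e 0, …, e (n - 1)` to the function variables `0, …, n - 1`. -/
def Sub.consFn (σ : Sub) : ℕ → (ℕ → Term .fn) → Sub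
  | 0, _ => σ
  | n + 1, e => (σ.consFn n fun i => e (i + 1)).cons (e 0)

namespace Henkin

variable {T : Formula → Prop}

theorem allFn_subst_of_forall (hT : Henkin RCA₀ T) {n : ℕ} {φ : Formula} {σ : Sub}
    (h : ∀ e, T (φ.subst (σ.consFn n e))) : T ((allFn n φ).subst σ) := by
  induction n generalizing φ with
  | zero => exact h fun _ => rZero
  | succ n ih =>
    refine ih fun e => hT.all.2 fun t => ?_
    rw [subst_up_inst]
    exact h fun i => i.casesOn t e

theorem exFn_subst_of_subst (hT : Henkin RCA₀ T) {n : ℕ} {φ : Formula} {σ : Sub} (e : ℕ → Term .fn)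
    (h : T (φ.subst (σ.consFn n e))) : T ((exFn n φ).subst σ) := by
  induction n generalizing φ e with
  | zero => exact h
  | succ n ih =>
    refine ih (fun i => e (i + 1)) (hT.ex_iff.2 ⟨e 0, ?_⟩)
    rwa [subst_up_inst]

end Henkin

namespace Henkin

variable {T : Formula → Prop} {hT : Henkin RCA₀ T}

/-! ### Real numbers -/

section

variable (hT)

theorem isReal_iff {f : Term .fn} :
    T (isReal f) ↔ hT.seqSpace.ConvergesWith 1 (hT.seq f) := by
  have h_dist (t u : Term .num) :
      T (qDistLe (.app f t) (.app f (.add t u)) (qDyadic one t)) ↔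
        |hT.seq f (hT.den t) - hT.seq f (hT.den t + hT.den u)| ≤ 1 * hT.e (hT.den t) := by
    rw [hT.qDistLe_iff, den_app, den_app, den_add, val_den_qDyadic, den_one, map_one]
    rfl
  calc T (isReal f)
      ↔ ∀ t u, T (qDistLe (.app f t) (.app f (.add t u)) (qDyadic one t)) := by
        rw [isReal, hT.all]
        refine forall_congr' fun t => ?_
        rw [Formula.inst, Formula.subst, hT.all]
        refine forall_congr' fun u => ?_
        rw [subst_up_inst, Sub.single_cons]
        simp only [subst_qDistLe, Term.subst, Term.lift_lift_subst_double, subst_qDyadic]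
        rfl
    _ ↔ hT.seqSpace.ConvergesWith 1 (hT.seq f) := by
        simp only [h_dist, SeqSpace.ConvergesWith, hT.den_surjective.forall]
        rfl

theorem rEq_iff {f g : Term .fn} :
    T (rEq f g) ↔ ∀ k, |hT.seq f k - hT.seq g k| ≤ 2 * hT.e k := by
  have h_dist (t : Term .num) :
      T (qDistLe (.app f t) (.app g t) (qDyadic (succ one) t)) ↔
        |hT.seq f (hT.den t) - hT.seq g (hT.den t)| ≤ 2 * hT.e (hT.den t) := by
    rw [hT.qDistLe_iff, den_app, den_app, val_den_qDyadic, den_succ, den_one, map_add, map_one,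
      one_add_one_eq_two]
    rfl
  calc T (rEq f g)
      ↔ ∀ t, T (qDistLe (.app f t) (.app g t) (qDyadic (succ one) t)) := by
        rw [rEq, hT.all]
        refine forall_congr' fun t => ?_
        rw [Formula.inst]
        simp only [subst_qDistLe, Term.subst, Term.lift_subst_single, subst_qDyadic]
        rfl
    _ ↔ ∀ k, |hT.seq f k - hT.seq g k| ≤ 2 * hT.e k := by
        simp only [h_dist, hT.den_surjective.forall]

theorem seq_lam (s t : Term .num) :
    hT.seq (lam s) (hT.den t) = hT.val (hT.den (s.subst (Sub.single t))) := by
  rw [seq, app_lam]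

theorem seq_rZero (k : hT.Num) : hT.seq rZero k = 0 := by
  obtain ⟨t, rfl⟩ := hT.den_surjective k
  rw [rZero, seq_lam, subst_qMk, val_den_qMk]
  simp only [Term.subst, sub_self, zero_div]

theorem seq_rOne (k : hT.Num) : hT.seq rOne k = 1 := by
  obtain ⟨t, rfl⟩ := hT.den_surjective k
  rw [rOne, seq_lam, subst_qMk, val_den_qMk]
  simp only [Term.subst, one, den_succ, den_zero, zero_add, map_zero, map_one, sub_zero, div_one]

theorem seq_rAdd (f g : Term .fn) (k : hT.Num) :
    hT.seq (rAdd f g) k = hT.seq f (1 + k) + hT.seq g (1 + k) := by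
  obtain ⟨t, rfl⟩ := hT.den_surjective k
  rw [rAdd, seq_lam, subst_qAdd, val_den_qAdd]
  simp only [Term.subst, Term.lift_subst_single, den_app, den_succ]
  rw [add_comm 1]
  rfl

theorem seq_rOpp (f : Term .fn) (k : hT.Num) : hT.seq (rOpp f) k = -hT.seq f k := by
  obtain ⟨t, rfl⟩ := hT.den_surjective k
  rw [rOpp, seq_lam, subst_qOpp, val_den_qOpp]
  simp only [Term.subst, Term.lift_subst_single, den_app]
  rfl

theorem seq_rMul (f g : Term .fn) : ∃ m : hT.Num,
    |hT.seq f 0| + |hT.seq g 0| + 2 ≤ hT.ι m ∧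
      ∀ k, hT.seq (rMul f g) k = hT.seq f (m + k) * hT.seq g (m + k) := by
  refine ⟨hT.den (add (add (qBound (.app f zero)) (qBound (.app g zero))) (succ one)), ?_,
    fun k => ?_⟩
  · have h_f := hT.abs_val_den_le (.app f zero)
    have h_g := hT.abs_val_den_le (.app g zero)
    rw [den_app, den_zero] at h_f h_g
    rw [den_add, den_add, den_succ, den_one, map_add, map_add, map_add hT.ι 1, map_one, seq, seq]
    linarith
  · obtain ⟨t, rfl⟩ := hT.den_surjective k
    rw [rMul, seq_lam, subst_qMul, val_den_qMul]
    simp only [Term.subst, Term.lift_subst_single, den_app, subst_qBound, one]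
    rfl

end

/-- The real number `f` of the theory denotes the element `x` of the field of limits. -/
def Rep (f : Term .fn) (x : hT.seqSpace.Limit) : Prop :=
  ∃ h : hT.seq f ∈ hT.seqSpace.convergent,
    hT.seqSpace.ConvergesWith 1 (hT.seq f) ∧ hT.seqSpace.lim ⟨_, h⟩ = x

section

variable {f g : Term .fn} {x y : hT.seqSpace.Limit}

theorem Rep.isReal (h : Rep f x) : T (isReal f) := hT.isReal_iff.2 h.2.1

theorem exists_rep_of_isReal (h : T (RCA.isReal f)) : ∃ x : hT.seqSpace.Limit, Rep f x :=
  have hf := hT.isReal_iff.1 h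
  ⟨_, ⟨⟨f, rfl⟩, 1, hf⟩, hf, rfl⟩

theorem exists_rep (x : hT.seqSpace.Limit) : ∃ f, Rep f x := by
  obtain ⟨⟨_, ⟨f, rfl⟩, h⟩, hf, rfl⟩ := SeqSpace.exists_lim_eq x
  exact ⟨f, ⟨⟨f, rfl⟩, h⟩, hf, rfl⟩

theorem Rep.rEq_iff (h : Rep f x) (h' : Rep g y) : T (rEq f g) ↔ x = y := by
  obtain ⟨_, hf, rfl⟩ := h
  obtain ⟨_, hg, rfl⟩ := h'
  rw [hT.rEq_iff, SeqSpace.lim_eq_lim_iff hf hg]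
  rfl

/-- The arithmetical operations of the theory shift their arguments to stay quickly converging. -/
theorem Rep.of_shift {s : hT.seqSpace.convergent} (m : hT.Num)
    (h : ∀ k, hT.seq f k = s.1 (m + k)) (hf : hT.seqSpace.ConvergesWith 1 (hT.seq f)) :
    Rep f (hT.seqSpace.lim s) := by
  refine ⟨⟨⟨f, rfl⟩, 1, hf⟩, hf, ?_⟩
  rw [← SeqSpace.lim_shift m s]
  congr 2
  exact funext h

theorem Rep.of_const {s : hT.seqSpace.convergent} {a : hT.Rat} (hs : ∀ k, s.1 k = a)
    (h : ∀ k, hT.seq f k = a) : Rep f (hT.seqSpace.lim s) := by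
  refine .of_shift 0 (fun k => (h k).trans (hs _).symm) fun k i => ?_
  rw [h, h, sub_self, abs_zero, one_mul]
  exact (e_pos k).le

theorem Rep.rZero : Rep (hT := hT) rZero 0 := by
  rw [← map_zero hT.seqSpace.lim]
  exact .of_const (fun _ => rfl) hT.seq_rZero

theorem Rep.rOne : Rep (hT := hT) rOne 1 := by
  rw [← map_one hT.seqSpace.lim]
  exact .of_const (fun _ => rfl) hT.seq_rOne

theorem Rep.rOpp (h : Rep f x) : Rep (rOpp f) (-x) := by
  obtain ⟨_, hf, rfl⟩ := h
  rw [← map_neg]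
  refine .of_shift 0 (fun k => by rw [seq_rOpp, zero_add]; rfl) ?_
  rw [show hT.seq (RCA.rOpp f) = -hT.seq f from funext (hT.seq_rOpp f)]
  exact hf.neg

theorem Rep.rAdd (h : Rep f x) (h' : Rep g y) : Rep (rAdd f g) (x + y) := by
  obtain ⟨_, hf, rfl⟩ := h
  obtain ⟨_, hg, rfl⟩ := h'
  rw [← map_add]
  refine .of_shift 1 (hT.seq_rAdd f g) ?_
  rw [show hT.seq (RCA.rAdd f g) = _ from funext (hT.seq_rAdd f g)]
  refine ((hf.shift 1).add (hg.shift 1)).mono (le_of_eq ?_)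
  rw [one_mul, ← two_mul]
  exact two_mul_e_one

theorem Rep.rMul (h : Rep f x) (h' : Rep g y) : Rep (rMul f g) (x * y) := by
  obtain ⟨_, hf, rfl⟩ := h
  obtain ⟨_, hg, rfl⟩ := h'
  obtain ⟨m, hm, h_seq⟩ := hT.seq_rMul f g
  rw [← map_mul]
  refine .of_shift m h_seq ?_
  rw [show hT.seq (RCA.rMul f g) = _ from funext h_seq]
  exact hf.mul_shift hg ((mul_le_mul_of_nonneg_left hm (e_pos m).le).trans (e_mul_ι_le_one m))

end

/-! ### Complex numbers and matrices -/

/-- The complex number `z` of the theory denotes `x`. -/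
def CRep (z : CTerm) (x : Cplx hT.seqSpace.Limit) : Prop := Rep z.re x.re ∧ Rep z.im x.im

section

variable {z w : CTerm} {x y : Cplx hT.seqSpace.Limit}

theorem CRep.isComplex (h : CRep z x) : T (isComplex z) := hT.and_iff.2 ⟨h.1.isReal, h.2.isReal⟩

theorem exists_cRep_of_isComplex (h : T (RCA.isComplex z)) :
    ∃ x : Cplx hT.seqSpace.Limit, CRep z x := by
  obtain ⟨h_re, h_im⟩ := hT.and_iff.1 h
  obtain ⟨a, ha⟩ := exists_rep_of_isReal (hT := hT) h_re
  obtain ⟨b, hb⟩ := exists_rep_of_isReal (hT := hT) h_im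
  exact ⟨⟨a, b⟩, ha, hb⟩

theorem CRep.cEq_iff (h : CRep z x) (h' : CRep w y) : T (cEq z w) ↔ x = y := by
  rw [cEq, hT.and_iff, h.1.rEq_iff h'.1, h.2.rEq_iff h'.2, QuadraticAlgebra.ext_iff]

theorem CRep.cZero : CRep (hT := hT) cZero 0 := ⟨.rZero, .rZero⟩

theorem CRep.cOne : CRep (hT := hT) cOne 1 := ⟨.rOne, .rZero⟩

theorem CRep.cAdd (h : CRep z x) (h' : CRep w y) : CRep (cAdd z w) (x + y) :=
  ⟨h.1.rAdd h'.1, h.2.rAdd h'.2⟩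

theorem CRep.cMul (h : CRep z x) (h' : CRep w y) : CRep (cMul z w) (x * y) := by
  have h_re : (x * y).re = x.re * y.re + -(x.im * y.im) := by
    rw [QuadraticAlgebra.re_mul]
    ring
  have h_im : (x * y).im = x.re * y.im + x.im * y.re := by
    rw [QuadraticAlgebra.im_mul]
    ring
  rw [CRep, h_re, h_im]
  exact ⟨(h.1.rMul h'.1).rAdd (h.2.rMul h'.2).rOpp, (h.1.rMul h'.2).rAdd (h.2.rMul h'.1)⟩

end

/-- The matrix `A` of the theory denotes the matrix `M`. -/
def MRep (A : MTerm) (M : Matrix (Fin 2) (Fin 2) (Cplx hT.seqSpace.Limit)) : Prop :=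
  (CRep A.a (M 0 0) ∧ CRep A.b (M 0 1)) ∧ CRep A.c (M 1 0) ∧ CRep A.d (M 1 1)

section

variable {A B : MTerm} {M N : Matrix (Fin 2) (Fin 2) (Cplx hT.seqSpace.Limit)}

theorem MRep.isMatrix (h : MRep A M) : T (isMatrix A) :=
  hT.and_iff.2 ⟨hT.and_iff.2 ⟨h.1.1.isComplex, h.1.2.isComplex⟩,
    hT.and_iff.2 ⟨h.2.1.isComplex, h.2.2.isComplex⟩⟩

theorem exists_mRep_of_isMatrix (h : T (RCA.isMatrix A)) :
    ∃ M : Matrix (Fin 2) (Fin 2) (Cplx hT.seqSpace.Limit), MRep A M := by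
  simp only [RCA.isMatrix, hT.and_iff] at h
  obtain ⟨⟨ha, hb⟩, hc, hd⟩ := h
  obtain ⟨a, ha⟩ := exists_cRep_of_isComplex (hT := hT) ha
  obtain ⟨b, hb⟩ := exists_cRep_of_isComplex (hT := hT) hb
  obtain ⟨c, hc⟩ := exists_cRep_of_isComplex (hT := hT) hc
  obtain ⟨d, hd⟩ := exists_cRep_of_isComplex (hT := hT) hd
  exact ⟨!![a, b; c, d], ⟨ha, hb⟩, hc, hd⟩

theorem MRep.mEq_iff (h : MRep A M) (h' : MRep B N) : T (mEq A B) ↔ M = N := by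
  rw [mEq, hT.and_iff, hT.and_iff, hT.and_iff, h.1.1.cEq_iff h'.1.1, h.1.2.cEq_iff h'.1.2,
    h.2.1.cEq_iff h'.2.1, h.2.2.cEq_iff h'.2.2, ← matrix_eq_iff, ← Matrix.eta_fin_two,
    ← Matrix.eta_fin_two]

theorem MRep.mOne : MRep (hT := hT) mOne 1 := ⟨⟨.cOne, .cZero⟩, .cZero, .cOne⟩

theorem MRep.mMul (h : MRep A M) (h' : MRep B N) : MRep (mMul A B) (M * N) := by
  simp only [MRep, Matrix.mul_apply, Fin.sum_univ_two]
  exact ⟨⟨(h.1.1.cMul h'.1.1).cAdd (h.1.2.cMul h'.2.1),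
      (h.1.1.cMul h'.1.2).cAdd (h.1.2.cMul h'.2.2)⟩,
    (h.2.1.cMul h'.1.1).cAdd (h.2.2.cMul h'.2.1), (h.2.1.cMul h'.1.2).cAdd (h.2.2.cMul h'.2.2)⟩

theorem MRep.isInverse_iff (h : MRep A M) (h' : MRep B N) :
    T (isInverse A B) ↔ M * N = 1 ∧ N * M = 1 := by
  rw [isInverse, hT.and_iff, (h.mMul h').mEq_iff .mOne, (h'.mMul h).mEq_iff .mOne]

theorem MRep.isJordan_iff (h : MRep A M) : T (isJordan A) ↔ IsJordan M := by
  rw [isJordan, hT.and_iff, hT.or_iff, hT.and_iff, h.2.1.cEq_iff .cZero, h.1.2.cEq_iff .cZero,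
    h.1.2.cEq_iff .cOne, h.1.1.cEq_iff h.2.2, IsJordan]

end

/-! ### Jordan decompositions in the theory -/

theorem hasJordanDecomposition_subst (hT : Henkin RCA₀ T) {σ : Sub}
    {M : Matrix (Fin 2) (Fin 2) (Cplx hT.seqSpace.Limit)} (hM : MRep ((mVar 0).subst σ) M) :
    T (hasJordanDecomposition.subst σ) := by
  obtain ⟨U, J, V, hUV, hVU, hJ, hMU⟩ :=
    exists_jordan (Cplx.isSquare SeqSpace.Limit.exists_mul_self_eq_or_eq_neg) M
  choose F hF using exists_rep (hT := hT)
  let entries : List (Cplx hT.seqSpace.Limit) := [U 0 0, U 0 1, U 1 0, U 1 1,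
    J 0 0, J 0 1, J 1 0, J 1 1, V 0 0, V 0 1, V 1 0, V 1 1]
  let names : List (Term .fn) := entries.flatMap fun x => [F x.re, F x.im]
  refine hT.exFn_subst_of_subst (fun i => names.getD i rZero) ?_
  set τ := σ.consFn 24 fun i => names.getD i rZero
  have rU : MRep ((mVar 0).subst τ) U := ⟨⟨⟨hF _, hF _⟩, hF _, hF _⟩, ⟨hF _, hF _⟩, hF _, hF _⟩
  have rJ : MRep ((mVar 8).subst τ) J := ⟨⟨⟨hF _, hF _⟩, hF _, hF _⟩, ⟨hF _, hF _⟩, hF _, hF _⟩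
  have rV : MRep ((mVar 16).subst τ) V := ⟨⟨⟨hF _, hF _⟩, hF _, hF _⟩, ⟨hF _, hF _⟩, hF _, hF _⟩
  have rM : MRep ((mVar 24).subst τ) M := hM
  simp only [subst_and, subst_isMatrix, subst_isInverse, subst_isJordan, subst_mEq, subst_mMul,
    hT.and_iff, rU.isInverse_iff rV, rJ.isJordan_iff, rM.mEq_iff ((rU.mMul rJ).mMul rV)]
  exact ⟨⟨rU.isMatrix, rJ.isMatrix, rV.isMatrix⟩, ⟨hUV, hVU⟩, hJ, hMU⟩

theorem holds_jordanSentence (hT : Henkin RCA₀ T) : T jordanSentence := by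
  rw [← jordanSentence.subst_id]
  refine hT.allFn_subst_of_forall fun _ => hT.imp.2 fun hM => ?_
  rw [subst_isMatrix] at hM
  exact hT.hasJordanDecomposition_subst (exists_mRep_of_isMatrix (hT := hT) hM).choose_spec

end Henkin

end RCA

theorem mainTheorem8 : RCA.Provable RCA.RCA₀ RCA.jordanSentence :=
  RCA.Provable.of_henkin (fun _ h σ => h.subst σ) fun _ hT => hT.holds_jordanSentence
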